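/- \textbf{Setting.} Let $d\ge 1$, let $\Omega\subset\mathbb R^d$ be a bounded open set (for instance a polygonal Lipschitz domain), and let $a\in C(\bar\Omega)$ with $0<\alpha_{\min}\le a\le\alpha_{\max}$ on $\bar\Omega$. Write $\langle\cdot,\cdot\rangle$ and $\|\cdot\|$ for the inner product and norm of $L^2(\Omega)$, let $H^1_0(\Omega)$ be the closure of $C_c^\infty(\Omega)$ in $H^1(\Omega)$, and put $a(z,v)=\int_\Omega a\nabla z\cdot\nabla v\,dx$. Let $C_\Omega$ be the best constant in $\|v\|^2\le C_\Omega\|\nabla v\|^2$, $v\in H^1_0(\Omega)$. Let $0=t^0<t^1<\dots<t^N$, $N\ge1$, $k_n=t^n-t^{n-1}$, let $f\in L^2(0,t^N;L^2(\Omega))$ be a function with values $f^n:=f(t^n)$ at the nodes, $u_0\in H^1_0(\Omega)$, $u_1\in L^2(\Omega)$, and let $u\in L^2(0,t^N;H^1_0(\Omega))$ with $u_t\in L^2(0,t^N;L^2(\Omega))$ and $u_{tt}\in L^2(0,t^N;H^{-1}(\Omega))$ be the weak solution of $u_{tt}-\nabla\cdot(a\nabla u)=f$, $u(0)=u_0$,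 $u_t(0)=u_1$. \textbf{Scheme.} Let $V_h^0,\dots,V_h^N$ be finite-dimensional subspaces of $H^1_0(\Omega)$ (for instance conforming finite element spaces on meshes that change from step to step), $\Pi^n:L^2(\Omega)\to V_h^n$ the orthogonal $L^2$-projection, and $\pi^0:L^2(\Omega)\to V_h^0$ a linear projection onto $V^0_h$. Put $U^0=\pi^0u_0$ and $V^0=\pi^0u_1$. For a sequence $x^0,\dots,x^N$ with a prescribed $\partial x^0$ put $\partial x^n=(x^n-x^{n-1})/k_n$ and $\partial^2x^n=(\partial x^n-\partial x^{n-1})/k_n$ for $n\ge1$. Let $U^n\in V^n_h$, $n=1,\dots,N$, satisfy, with $\partial U^0=V^0$, $$\langle\partial^2U^n,\chi\rangle+a(U^n,\chi)=\langle f^n,\chi\rangle\qquad\forall\chi\in V_h^n .$$ \textbf{Reconstructions.} Let $A^n:V_h^n\to V_h^n$ be given by $\langle A^nq,\chi\rangle=a(q,\chi)$ for all $q,\chi\in V_h^n$. Put $\bar f^0=f(0)$ and $\bar f^n=k_n^{-1}\int_{t^{n-1}}^{t^n}f\,dt$ for $n\ge 1$, $g^n=A^nU^n-\Pi^nf^n+\bar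 f^n$ for $n\ge 0$, and $\partial g^0=A^0V^0-\Pi^0f^0+f^0$. Let $w^n,\partial w^0\in H^1_0(\Omega)$ solve $a(w^n,v)=\langle g^n,v\rangle$ and $a(\partial w^0,v)=\langle\partial g^0,v\rangle$ for all $v\in H^1_0(\Omega)$. Define on $[0,t^N]$ the $C^1$-in-time function $U$ by $U(0)=U^0$ and, for $t\in(t^{n-1},t^n]$, $$U(t)=\tfrac{t-t^{n-1}}{k_n}U^n+\tfrac{t^n-t}{k_n}U^{n-1}-\tfrac{(t-t^{n-1})(t^n-t)^2}{k_n}\partial^2U^n,$$ and define $w(t)$ by the same formula from the $w^n$ and $\partial w^0$. Put $e=U-u$, $\epsilon=w-U$ and $\mu^n(t)=-6k_n^{-1}\bigl(t-\tfrac12(t^n+t^{n-1})\bigr)$. \textbf{Indicators.} For $t^{m-1}<\tau\le t^m$ let $$\eta_1(\tau)=\sum_{j=1}^{m-1}\int_{t^{j-1}}^{t^j}\|(I-\Pi^j)U_t\|+\int_{t^{m-1}}^\tau\|(I-\Pi^m)U_t\|+\sum_{j=1}^{m-1}(\tau-t^j)\|(\Pi^{j+1}-\Pi^j)\partial U^j\|+\tau\|(I-\Pi^1)V^0\|,$$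 $$\eta_2(\tau)=\int_0^\tau\|\mathcal G\|,\qquad \mathcal G(t)=\tfrac{(t^j-t)^2}{2}\partial g^j-\Bigl(\tfrac{(t^j-t)^4}{4k_j}-\tfrac{(t^j-t)^3}{3}\Bigr)\partial^2g^j-\gamma_j\quad\text{on }(t^{j-1},t^j],$$ where $\gamma_0=0$ and $\gamma_j=\gamma_{j-1}+\tfrac{k_j^2}{2}\partial g^j+\tfrac{k_j^3}{12}\partial^2g^j$, $$\eta_3(\tau)=\frac1{2\pi}\sum_{j=1}^{m-1}\Bigl(\int_{t^{j-1}}^{t^j}k_j^3\|\bar f^j-f\|^2\Bigr)^{1/2}+\Bigl(\int_{t^{m-1}}^\tau k_m^3\|\bar f^m-f\|^2\Bigr)^{1/2},$$ $$\eta_4(\tau)=\frac1{2\pi}\sum_{j=1}^{m-1}\Bigl(\int_{t^{j-1}}^{t^j}k_j^3\|\mu^j\partial^2U^j\|^2\Bigr)^{1/2}+\Bigl(\int_{t^{m-1}}^\tau k_m^3\|\mu^m\partial^2U^m\|^2\Bigr)^{1/2}.$$ \textbf{Theorem.} The functions $e$ and $\epsilon$ belong to $L^\infty(0,t^N;L^2(\Omega))$,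 $\epsilon_t$ is integrable on $(0,t^N)$ with values in $L^2(\Omega)$, and $$\|e\|_{L^\infty(0,t^N;L^2(\Omega))}\le\|\epsilon\|_{L^\infty(0,t^N;L^2(\Omega))}+\sqrt2\bigl(\|u_0-U(0)\|+\|\epsilon(0)\|\bigr)+2\Bigl(\int_0^{t^N}\|\epsilon_t\|+\sum_{i=1}^4\eta_i(t^N)\Bigr)+C_{a,N}\|u_1-V^0\|,$$ where $C_{a,N}=\min\bigl\{2t^N,\sqrt{2C_\Omega/\alpha_{\min}}\bigr\}$. -/

import Mathlib

open MeasureTheory Set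
open scoped ENNReal ContDiff RealInnerProductSpace

noncomputable section

namespace WaveFEM

/-! ### Function spaces -/

/-- `L²(Ω)`. -/
abbrev L2 {d : ℕ} (Ω : Set (EuclideanSpace ℝ (Fin d))) : Type :=
  Lp ℝ 2 (volume.restrict Ω)

/-- `L²(Ω)ᵈ`, the square integrable vector fields. -/
abbrev L2vec {d : ℕ} (Ω : Set (EuclideanSpace ℝ (Fin d))) : Type :=
  Lp (EuclideanSpace ℝ (Fin d)) 2 (volume.restrict Ω)

/-- The pairs `(φ, ∇φ)` with `φ ∈ C_c^∞(Ω)`, as a subspace of `L²(Ω) × L²(Ω)ᵈ`, which carries the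
norm `(‖v‖² + ‖G‖²)^{1/2}`. -/
def testGraph {d : ℕ} (Ω : Set (EuclideanSpace ℝ (Fin d))) :
    Submodule ℝ (WithLp 2 (L2 Ω × L2vec Ω)) where
  carrier := {p | ∃ φ : EuclideanSpace ℝ (Fin d) → ℝ,
    ContDiff ℝ ∞ φ ∧ HasCompactSupport φ ∧ tsupport φ ⊆ Ω ∧
    p.fst =ᵐ[volume.restrict Ω] φ ∧ p.snd =ᵐ[volume.restrict Ω] gradient φ}
  zero_mem' := by
    refine ⟨fun _ => 0, contDiff_const, HasCompactSupport.zero, ?_, ?_, ?_⟩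
    · have h : tsupport (fun _ : EuclideanSpace ℝ (Fin d) => (0 : ℝ)) = ∅ :=
        tsupport_eq_empty_iff.2 rfl
      rw [h]; exact empty_subset _
    · exact Lp.coeFn_zero _ _ _
    · refine (Lp.coeFn_zero _ _ _).trans (Filter.Eventually.of_forall fun x => ?_)
      simp [gradient_fun_const]
  add_mem' := by
    rintro p q ⟨φ, hφ, hφc, hφs, h1, h2⟩ ⟨ψ, hψ, hψc, hψs, h3, h4⟩
    refine ⟨φ + ψ, hφ.add hψ, hφc.add hψc,
      (tsupport_add φ ψ).trans (union_subset hφs hψs), ?_, ?_⟩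
    · exact (Lp.coeFn_add _ _).trans (h1.add h3)
    · refine (Lp.coeFn_add _ _).trans ((h2.add h4).trans
        (Filter.Eventually.of_forall fun x => ?_))
      have e1 : DifferentiableAt ℝ φ x := (hφ.differentiable (by simp)) x
      have e2 : DifferentiableAt ℝ ψ x := (hψ.differentiable (by simp)) x
      simp [gradient, fderiv_add e1 e2]
  smul_mem' := by
    rintro c p ⟨φ, hφ, hφc, hφs, h1, h2⟩
    refine ⟨c • φ, hφ.const_smul c, hφc.smul_left (f := fun _ => c),
      (tsupport_smul_subset_right (fun _ => c) φ).trans hφs, ?_, ?_⟩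
    · exact (Lp.coeFn_smul _ _).trans (h1.const_smul c)
    · refine (Lp.coeFn_smul _ _).trans ((h2.const_smul c).trans
        (Filter.Eventually.of_forall fun x => ?_))
      have e1 : DifferentiableAt ℝ φ x := (hφ.differentiable (by simp)) x
      simp [gradient, fderiv_const_smul e1 c]

/-- `H¹₀(Ω)`: the closure of `C_c^∞(Ω)` in the norm `(‖v‖² + ‖∇v‖²)^{1/2}`. An element is stored as
the pair of the function and its weak gradient. -/
def H10 {d : ℕ} (Ω : Set (EuclideanSpace ℝ (Fin d))) :
    Submodule ℝ (WithLp 2 (L2 Ω × L2vec Ω)) :=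
  (testGraph Ω).topologicalClosure

/-- The inclusion `H¹₀(Ω) → L²(Ω)`. -/
def incl {d : ℕ} (Ω : Set (EuclideanSpace ℝ (Fin d))) : H10 Ω →L[ℝ] L2 Ω :=
  (WithLp.fstL 2 ℝ (L2 Ω) (L2vec Ω)).comp (H10 Ω).subtypeL

/-- The weak gradient `∇ : H¹₀(Ω) → L²(Ω)ᵈ`. -/
def grad {d : ℕ} (Ω : Set (EuclideanSpace ℝ (Fin d))) : H10 Ω →L[ℝ] L2vec Ω :=
  (WithLp.sndL 2 ℝ (L2 Ω) (L2vec Ω)).comp (H10 Ω).subtypeL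

/-- `H⁻¹(Ω)`, the dual of `H¹₀(Ω)`. -/
abbrev Hneg1 {d : ℕ} (Ω : Set (EuclideanSpace ℝ (Fin d))) : Type :=
  StrongDual ℝ (H10 Ω)

/-- The inclusion `L²(Ω) → H⁻¹(Ω)`, `g ↦ (v ↦ ⟨g, v⟩)`. -/
def toHneg1 {d : ℕ} (Ω : Set (EuclideanSpace ℝ (Fin d))) (g : L2 Ω) : Hneg1 Ω :=
  (innerSL ℝ g).comp (incl Ω)

/-- The bilinear form `a(z, v) = ∫_Ω a ∇z·∇v dx`. -/
def aForm {d : ℕ} {Ω : Set (EuclideanSpace ℝ (Fin d))} (a : EuclideanSpace ℝ (Fin d) → ℝ)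
    (z v : H10 Ω) : ℝ :=
  ∫ x in Ω, a x * ⟪grad Ω z x, grad Ω v x⟫

/-- The constant `C_Ω` of the Poincaré–Friedrichs inequality: the best `C` with
`‖v‖² ≤ C ‖∇v‖²` for all `v ∈ H¹₀(Ω)`. -/
def poincareConst {d : ℕ} (Ω : Set (EuclideanSpace ℝ (Fin d))) : ℝ :=
  sInf {C : ℝ | 0 ≤ C ∧ ∀ v : H10 Ω, ‖incl Ω v‖ ^ 2 ≤ C * ‖grad Ω v‖ ^ 2}

/-! ### The wave equation -/

/-- `x : (0,T) → X` belongs to `L²(0,T;X)`. -/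
def IsL2Time {X : Type*} [NormedAddCommGroup X] (T : ℝ) (x : ℝ → X) : Prop :=
  MemLp x 2 (volume.restrict (Ioc 0 T))

/-- `x'` is the weak time derivative of `x` on `(0,T)`, and the continuous representative of `x`
takes the value `x₀` at time `0`. -/
def HasTimeDeriv {X : Type*} [NormedAddCommGroup X] [NormedSpace ℝ X] (T : ℝ)
    (x : ℝ → X) (x₀ : X) (x' : ℝ → X) : Prop :=
  ∀ᵐ s ∂(volume.restrict (Ioc 0 T)), x s = x₀ + ∫ r in (0 : ℝ)..s, x' r

/-- `u` is the weak solution of `u_tt - ∇·(a∇u) = f` in `(0,T) × Ω`, `u = 0` on `∂Ω`,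
`u(0) = u₀`, `u_t(0) = u₁`: `u ∈ L²(0,T;H¹₀)`, `u_t ∈ L²(0,T;L²)`, `u_tt ∈ L²(0,T;H⁻¹)` and
`⟨u_tt, v⟩ + a(u, v) = ⟨f, v⟩` for all `v ∈ H¹₀(Ω)` and almost every time. -/
def IsWeakSolution {d : ℕ} {Ω : Set (EuclideanSpace ℝ (Fin d))}
    (a : EuclideanSpace ℝ (Fin d) → ℝ) (T : ℝ) (f : ℝ → L2 Ω) (u₀ : H10 Ω) (u₁ : L2 Ω)
    (u : ℝ → H10 Ω) : Prop :=
  IsL2Time T u ∧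
  ∃ (ut : ℝ → L2 Ω) (utt : ℝ → Hneg1 Ω),
    IsL2Time T ut ∧ IsL2Time T utt ∧
    HasTimeDeriv T (fun s => incl Ω (u s)) (incl Ω u₀) ut ∧
    HasTimeDeriv T (fun s => toHneg1 Ω (ut s)) (toHneg1 Ω u₁) utt ∧
    ∀ᵐ s ∂(volume.restrict (Ioc 0 T)), ∀ v : H10 Ω,
      utt s v + aForm a (u s) v = ⟪f s, incl Ω v⟫

/-! ### Time discretization

The time nodes are `t 0 < t 1 < ⋯ < t N`; the `n`-th interval, `n ≥ 1`, is `(t (n-1), t n]`. -/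

/-- The time-step `k_n = tⁿ - tⁿ⁻¹`. -/
def step (t : ℕ → ℝ) (n : ℕ) : ℝ := t n - t (n - 1)

/-- The backward difference `∂xⁿ = (xⁿ - xⁿ⁻¹)/k_n` for `n ≥ 1`, with a prescribed `∂x⁰ = dx₀`. -/
def bdiff {X : Type*} [AddCommGroup X] [Module ℝ X] (t : ℕ → ℝ) (x : ℕ → X) (dx₀ : X)
    (n : ℕ) : X :=
  if n = 0 then dx₀ else (step t n)⁻¹ • (x n - x (n - 1))

/-- The second backward difference `∂²xⁿ = (∂xⁿ - ∂xⁿ⁻¹)/k_n`, `n ≥ 1`. -/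
def bdiff2 {X : Type*} [AddCommGroup X] [Module ℝ X] (t : ℕ → ℝ) (x : ℕ → X) (dx₀ : X)
    (n : ℕ) : X :=
  (step t n)⁻¹ • (bdiff t x dx₀ n - bdiff t x dx₀ (n - 1))

/-- The three-point `C¹` time reconstruction on `[0, t N]` of the nodal values `x`, with initial
velocity `dx₀`. At time `0` it is `x 0`, its limit from the right. -/
def timeRec {X : Type*} [AddCommGroup X] [Module ℝ X] (t : ℕ → ℝ) (N : ℕ) (x : ℕ → X) (dx₀ : X)
    (s : ℝ) : X :=
  if s ≤ 0 then x 0 else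
  ∑ n ∈ Finset.Icc 1 N, (Ioc (t (n - 1)) (t n)).indicator (fun s =>
    ((s - t (n - 1)) / step t n) • x n + ((t n - s) / step t n) • x (n - 1)
      - ((s - t (n - 1)) * (t n - s) ^ 2 / step t n) • bdiff2 t x dx₀ n) s

/-- `μⁿ(s) = -6 k_n⁻¹ (s - (tⁿ + tⁿ⁻¹)/2)`. -/
def mu (t : ℕ → ℝ) (n : ℕ) (s : ℝ) : ℝ :=
  -6 * (step t n)⁻¹ * (s - (t n + t (n - 1)) / 2)

/-- The time averages `f̄⁰ = f(0)`, `f̄ⁿ = k_n⁻¹ ∫_{tⁿ⁻¹}^{tⁿ} f`. -/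
def fbar {X : Type*} [NormedAddCommGroup X] [NormedSpace ℝ X] (t : ℕ → ℝ) (f : ℝ → X)
    (n : ℕ) : X :=
  if n = 0 then f 0 else (step t n)⁻¹ • ∫ r in (t (n - 1))..(t n), f r

/-! ### The fully discrete scheme and the reconstructions -/

/-- The orthogonal projection `Π : L²(Ω) → V`, regarded as a map into `L²(Ω)`. -/
def proj {d : ℕ} {Ω : Set (EuclideanSpace ℝ (Fin d))} (V : Submodule ℝ (H10 Ω))
    [FiniteDimensional ℝ V] : L2 Ω →L[ℝ] L2 Ω :=
  (V.map (incl Ω : H10 Ω →ₗ[ℝ] L2 Ω)).starProjection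

/-- `A : V → V` is the discrete elliptic operator: `⟨A q, χ⟩ = a(q, χ)` for all `q, χ ∈ V`. -/
def IsDiscreteEllipticOp {d : ℕ} {Ω : Set (EuclideanSpace ℝ (Fin d))}
    (a : EuclideanSpace ℝ (Fin d) → ℝ) (V : Submodule ℝ (H10 Ω)) (A : V →ₗ[ℝ] V) : Prop :=
  ∀ q χ : V, ⟪incl Ω (A q), incl Ω χ⟫ = aForm a (q : H10 Ω) (χ : H10 Ω)

/-- `w ∈ H¹₀(Ω)` is the solution of `a(w, v) = ⟨g, v⟩` for all `v ∈ H¹₀(Ω)`. -/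
def IsEllipticSolution {d : ℕ} {Ω : Set (EuclideanSpace ℝ (Fin d))}
    (a : EuclideanSpace ℝ (Fin d) → ℝ) (g : L2 Ω) (w : H10 Ω) : Prop :=
  ∀ v : H10 Ω, aForm a w v = ⟪g, incl Ω v⟫

/-- `U⁰, …, Uᴺ` solves the implicit scheme
`⟨∂²Uⁿ, χ⟩ + a(Uⁿ, χ) = ⟨f(tⁿ), χ⟩` for all `χ ∈ Vⁿ`, `n = 1, …, N`,
with `U⁰ = π⁰ u₀` and `∂U⁰ = V⁰ = π⁰ u₁`. -/
def IsDiscreteSolution {d : ℕ} {Ω : Set (EuclideanSpace ℝ (Fin d))}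
    (a : EuclideanSpace ℝ (Fin d) → ℝ) (t : ℕ → ℝ) (N : ℕ) (V : ℕ → Submodule ℝ (H10 Ω))
    (π₀ : L2 Ω →ₗ[ℝ] V 0) (f : ℝ → L2 Ω) (u₀ : H10 Ω) (u₁ : L2 Ω) (U : (n : ℕ) → V n) : Prop :=
  U 0 = π₀ (incl Ω u₀) ∧
  ∀ n, 1 ≤ n → n ≤ N → ∀ χ : V n,
    ⟪incl Ω (bdiff2 t (fun j => (U j : H10 Ω)) (π₀ u₁ : H10 Ω) n), incl Ω χ⟫
      + aForm a (U n : H10 Ω) (χ : H10 Ω) = ⟪f (t n), incl Ω χ⟫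

/-- `gⁿ = Aⁿ Uⁿ - Πⁿ fⁿ + f̄ⁿ`. -/
def gRec {d : ℕ} {Ω : Set (EuclideanSpace ℝ (Fin d))} (t : ℕ → ℝ) (V : ℕ → Submodule ℝ (H10 Ω))
    [∀ n, FiniteDimensional ℝ (V n)] (A : (n : ℕ) → V n →ₗ[ℝ] V n) (f : ℝ → L2 Ω)
    (U : (n : ℕ) → V n) (n : ℕ) : L2 Ω :=
  incl Ω (A n (U n)) - proj (V n) (f (t n)) + fbar t f n

/-- `∂g⁰ = A⁰ V⁰ - Π⁰ f⁰ + f⁰`. -/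
def dgRec0 {d : ℕ} {Ω : Set (EuclideanSpace ℝ (Fin d))} (V : ℕ → Submodule ℝ (H10 Ω))
    [∀ n, FiniteDimensional ℝ (V n)] (A : (n : ℕ) → V n →ₗ[ℝ] V n) (f : ℝ → L2 Ω)
    (V0 : V 0) : L2 Ω :=
  incl Ω (A 0 V0) - proj (V 0) (f 0) + f 0

/-! ### The error indicators

They are evaluated at a time `τ` with `t (m-1) < τ ≤ t m`, `m ≥ 1`. -/

/-- The mesh change indicator `η₁(τ)`, for the nodal values `U` in `L²(Ω)`, the initial velocity
`V0` and the time reconstruction `Ut`. -/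
def eta1 {d : ℕ} {Ω : Set (EuclideanSpace ℝ (Fin d))} (t : ℕ → ℝ) (V : ℕ → Submodule ℝ (H10 Ω))
    [∀ n, FiniteDimensional ℝ (V n)] (U : ℕ → L2 Ω) (V0 : L2 Ω) (Ut : ℝ → L2 Ω)
    (m : ℕ) (τ : ℝ) : ℝ :=
  ((∑ j ∈ Finset.Icc 1 (m - 1),
      ∫ s in (t (j - 1))..(t j), ‖deriv Ut s - proj (V j) (deriv Ut s)‖)
    + ∫ s in (t (m - 1))..τ, ‖deriv Ut s - proj (V m) (deriv Ut s)‖)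
  + ((∑ j ∈ Finset.Icc 1 (m - 1),
      (τ - t j) * ‖proj (V (j + 1)) (bdiff t U V0 j) - proj (V j) (bdiff t U V0 j)‖)
    + τ * ‖V0 - proj (V 1) V0‖)

/-- `γ₀ = 0`, `γ_j = γ_{j-1} + (k_j²/2) ∂gʲ + (k_j³/12) ∂²gʲ`. -/
def gam {X : Type*} [AddCommGroup X] [Module ℝ X] (t : ℕ → ℝ) (g : ℕ → X) (dg₀ : X) : ℕ → X
  | 0 => 0
  | j + 1 => gam t g dg₀ j + (step t (j + 1) ^ 2 / 2) • bdiff t g dg₀ (j + 1)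
      + (step t (j + 1) ^ 3 / 12) • bdiff2 t g dg₀ (j + 1)

/-- The function `𝒢` on `(0, t N]`, given by `𝒢ʲ` on the `j`-th interval. -/
def evolG {X : Type*} [AddCommGroup X] [Module ℝ X] (t : ℕ → ℝ) (N : ℕ) (g : ℕ → X) (dg₀ : X)
    (s : ℝ) : X :=
  ∑ j ∈ Finset.Icc 1 N, (Ioc (t (j - 1)) (t j)).indicator (fun s =>
    ((t j - s) ^ 2 / 2) • bdiff t g dg₀ j
      - ((t j - s) ^ 4 / (4 * step t j) - (t j - s) ^ 3 / 3) • bdiff2 t g dg₀ j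
      - gam t g dg₀ j) s

/-- The evolution error indicator `η₂(τ) = ∫₀^τ ‖𝒢‖`. -/
def eta2 {X : Type*} [NormedAddCommGroup X] [NormedSpace ℝ X] (t : ℕ → ℝ) (N : ℕ) (g : ℕ → X)
    (dg₀ : X) (τ : ℝ) : ℝ :=
  ∫ s in (0 : ℝ)..τ, ‖evolG t N g dg₀ s‖

/-- The data error indicator `η₃(τ)`. -/
def eta3 {X : Type*} [NormedAddCommGroup X] [NormedSpace ℝ X] (t : ℕ → ℝ) (f : ℝ → X)
    (m : ℕ) (τ : ℝ) : ℝ :=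
  1 / (2 * Real.pi) * (∑ j ∈ Finset.Icc 1 (m - 1),
      √(∫ s in (t (j - 1))..(t j), step t j ^ 3 * ‖fbar t f j - f s‖ ^ 2))
    + √(∫ s in (t (m - 1))..τ, step t m ^ 3 * ‖fbar t f m - f s‖ ^ 2)

/-- The time reconstruction error indicator `η₄(τ)`. -/
def eta4 {X : Type*} [NormedAddCommGroup X] [NormedSpace ℝ X] (t : ℕ → ℝ) (U : ℕ → X) (V0 : X)
    (m : ℕ) (τ : ℝ) : ℝ :=
  1 / (2 * Real.pi) * (∑ j ∈ Finset.Icc 1 (m - 1),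
      √(∫ s in (t (j - 1))..(t j), step t j ^ 3 * ‖mu t j s • bdiff2 t U V0 j‖ ^ 2))
    + √(∫ s in (t (m - 1))..τ, step t m ^ 3 * ‖mu t m s • bdiff2 t U V0 m‖ ^ 2)

end WaveFEM

end

noncomputable section

namespace WaveFEM

/-! ### Integration by parts for primitives of Bochner integrable functions -/

section ByParts

variable {E F : Type*} [NormedAddCommGroup E] [NormedSpace ℝ E]
  [NormedAddCommGroup F] [NormedSpace ℝ F]

/-! Put ρ = w - u, so that e = ρ - ε and only ρ has to be estimated. The nodal values wⁿ and gⁿ are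
interpolated in time by the same formula, hence a(w(t), v) = ⟨g(t), v⟩ for all t, and therefore (U -
u)_tt + a(ρ, ·) = R with the computable residual R = U_tt + g - f, while ρ_t = (U - u)_t + ε_t.

The value of ρ at a time τ is found by duality. Let z solve the homogeneous wave equation backwards
from z(τ) = 0, z'(τ) = -φ with φ = ρ(τ). Two integrations by parts (`dual_representation`) express
‖φ‖² through the initial errors, ε_t and R, each paired with z or z'. Conservation of energy gives
‖z'‖ ≤ ‖φ‖, so a factor ‖φ‖ cancels and no Gronwall constant appears. To have the dual solution
without semigroup theory, δ a(z'', v) is added to the equation. It becomes an ODE with a bounded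
operator, solved by the exponential; the price is a term of order √δ, and δ → 0 in `dual_stability`.

Extended by zero after τ, the dual solution is Lipschitz in L² and vanishes at the final time. Only
these two facts (`IsTest`) enter the bound for the residual, which can thus be made over complete
time intervals. The scheme says gⁿ = f̄ⁿ - Πⁿ∂²Uⁿ (`gRec_eq`), and U_tt = (1 + μⁿ)∂²Uⁿ, so on the
n-th interval R = (I - Πⁿ)U_tt + (g - gⁿ) + (f̄ⁿ - f) + μⁿ Πⁿ∂²Uⁿ. The first two terms are time
derivatives, of (I - Πⁿ)U_t and of 𝒢, and are integrated by parts. The nodal terms of the first sum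
up to the mesh change terms; those of the second telescope, since γ makes 𝒢 continuous. The last two
have mean value zero, so the test function may be replaced by its deviation from its value at the
midpoint (`IsTest.integral_mean_zero_le`). The four terms give the four indicators in `residual_le`.

The outcome has constants no larger than the stated ones: 1 in place of √2, and no doubling inside
the minimum. -/

lemma integrable_bilin_of_bounded {α : Type*} [MeasurableSpace α] {μ : Measure α}
    (B : E →L[ℝ] F →L[ℝ] ℝ) {x : α → E} {y : α → F} (hx : Integrable x μ)
    (hy : AEStronglyMeasurable y μ) (C : ℝ) (hC : ∀ᵐ s ∂μ, ‖y s‖ ≤ C) :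
    Integrable (fun s => B (x s) (y s)) μ := by
  refine Integrable.mono' ((hx.norm.const_mul ‖B‖).mul_const C)
    (B.aestronglyMeasurable_comp₂ hx.1 hy) ?_
  filter_upwards [hC] with s hs
  exact (B.le_opNorm₂ _ _).trans (mul_le_mul_of_nonneg_left hs (by positivity))

lemma intervalIntegrable_bilin_left (B : E →L[ℝ] F →L[ℝ] ℝ) {x : ℝ → E} {y : ℝ → F} {a b : ℝ}
    (hab : a ≤ b) (hx : IntervalIntegrable x volume a b) (hy : ContinuousOn y (Icc a b)) :
    IntervalIntegrable (fun s => B (x s) (y s)) volume a b := by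
  rw [intervalIntegrable_iff_integrableOn_Ioc_of_le hab] at hx ⊢
  obtain ⟨C, hC⟩ := isCompact_Icc.exists_bound_of_continuousOn hy
  refine integrable_bilin_of_bounded B hx
    ((hy.mono Ioc_subset_Icc_self).aestronglyMeasurable measurableSet_Ioc) C ?_
  filter_upwards [ae_restrict_mem measurableSet_Ioc] with s hs using hC s (Ioc_subset_Icc_self hs)

lemma intervalIntegrable_bilin_right (B : E →L[ℝ] F →L[ℝ] ℝ) {x : ℝ → E} {y : ℝ → F} {a b : ℝ}
    (hab : a ≤ b) (hx : ContinuousOn x (Icc a b)) (hy : IntervalIntegrable y volume a b) :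
    IntervalIntegrable (fun s => B (x s) (y s)) volume a b :=
  intervalIntegrable_bilin_left B.flip hab hy hx

lemma continuousOn_primitive_Icc {x' : ℝ → E} {a b : ℝ} (hab : a ≤ b)
    (hx' : IntervalIntegrable x' volume a b) :
    ContinuousOn (fun s => ∫ r in a..s, x' r) (Icc a b) := by
  have := intervalIntegral.continuousOn_primitive_interval' hx' (left_mem_uIcc)
  rwa [uIcc_of_le hab] at this

lemma continuousOn_of_eq_primitive {x x' : ℝ → E} {a b : ℝ} (hab : a ≤ b)
    (hx' : IntervalIntegrable x' volume a b)
    (hx : ∀ s ∈ Icc a b, x s = x a + ∫ r in a..s, x' r) : ContinuousOn x (Icc a b) :=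
  (continuousOn_const.add (continuousOn_primitive_Icc hab hx')).congr hx

variable [CompleteSpace E] [CompleteSpace F]

/-- Integration by parts for two primitives of integrable functions vanishing at the left end. -/
lemma integral_bilin_primitive (B : E →L[ℝ] F →L[ℝ] ℝ) {x' : ℝ → E} {y' : ℝ → F} {a b : ℝ}
    (hab : a ≤ b) (hx' : IntervalIntegrable x' volume a b) (hy' : IntervalIntegrable y' volume a b) :
    (∫ s in a..b, B (x' s) (∫ r in a..s, y' r)) + ∫ s in a..b, B (∫ r in a..s, x' r) (y' s)
      = B (∫ r in a..b, x' r) (∫ r in a..b, y' r) := by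
  have hx := (intervalIntegrable_iff_integrableOn_Ioc_of_le hab).1 hx'
  have hy := (intervalIntegrable_iff_integrableOn_Ioc_of_le hab).1 hy'
  set μ : Measure ℝ := volume.restrict (Ioc a b) with hμ
  -- Fubini on the square: the two integrals on the left are the integrals of Φ over the two sides
  -- of the diagonal, and the right side is the integral over the whole square.
  let D : Set (ℝ × ℝ) := {p | p.2 ≤ p.1}
  have hD : MeasurableSet D := measurableSet_le measurable_snd measurable_fst
  let Φ : ℝ × ℝ → ℝ := fun p => B (x' p.1) (y' p.2)
  have hΦ : Integrable Φ (μ.prod μ) := by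
    refine Integrable.mono' ((hx.norm.mul_prod hy.norm).const_mul ‖B‖)
      (B.aestronglyMeasurable_comp₂ hx.1.comp_fst hy.1.comp_snd) (ae_of_all _ fun p => ?_)
    refine (B.le_opNorm₂ _ _).trans (le_of_eq (by ring))
  have hE1 : (∫ s in a..b, B (x' s) (∫ r in a..s, y' r)) = ∫ s, ∫ r, D.indicator Φ (s, r) ∂μ ∂μ := by
    rw [intervalIntegral.integral_of_le hab]
    refine setIntegral_congr_fun measurableSet_Ioc fun s hs => ?_
    have hys : IntegrableOn y' (Ioc a s) := hy.mono_set (Ioc_subset_Ioc_right hs.2)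
    rw [intervalIntegral.integral_of_le hs.1.le, ← (B (x' s)).integral_comp_comm hys,
      ← integral_indicator measurableSet_Ioc, hμ, ← integral_indicator measurableSet_Ioc]
    congr 1
    ext r
    by_cases h1 : r ∈ Ioc a s
    · have h2 : r ∈ Ioc a b := ⟨h1.1, h1.2.trans hs.2⟩
      have h3 : (s, r) ∈ D := h1.2
      rw [indicator_of_mem h1, indicator_of_mem h2, indicator_of_mem h3]
    · rw [indicator_of_notMem h1]
      by_cases h2 : r ∈ Ioc a b
      · have h3 : (s, r) ∉ D := fun h => h1 ⟨h2.1, h⟩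
        rw [indicator_of_mem h2, indicator_of_notMem h3]
      · rw [indicator_of_notMem h2]
  have hE2 : (∫ s in a..b, B (∫ r in a..s, x' r) (y' s))
      = ∫ r, ∫ s, Dᶜ.indicator Φ (s, r) ∂μ ∂μ := by
    rw [intervalIntegral.integral_of_le hab]
    refine setIntegral_congr_fun measurableSet_Ioc fun r hr => ?_
    have hxs : IntegrableOn x' (Ioc a r) := hx.mono_set (Ioc_subset_Ioc_right hr.2)
    -- The complement of `D` is a strict inequality, so the inner interval must be open at `r`.
    have e1 : B (∫ s in a..r, x' s) (y' r) = ∫ s in Ioo a r, B (x' s) (y' r) := by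
      rw [intervalIntegral.integral_of_le hr.1.le, ← integral_Ioc_eq_integral_Ioo]
      exact ((B.flip (y' r)).integral_comp_comm hxs).symm
    rw [e1, ← integral_indicator measurableSet_Ioo, hμ, ← integral_indicator measurableSet_Ioc]
    congr 1
    ext s
    by_cases h1 : s ∈ Ioo a r
    · have h2 : s ∈ Ioc a b := ⟨h1.1, h1.2.le.trans hr.2⟩
      have h3 : (s, r) ∈ Dᶜ := fun h => absurd h1.2 (not_lt.2 h)
      rw [indicator_of_mem h1, indicator_of_mem h2, indicator_of_mem h3]
    · rw [indicator_of_notMem h1]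
      by_cases h2 : s ∈ Ioc a b
      · have h3 : (s, r) ∉ Dᶜ := fun h => h1 ⟨h2.1, not_le.1 h⟩
        rw [indicator_of_mem h2, indicator_of_notMem h3]
      · rw [indicator_of_notMem h2]
  have i1 : Integrable (D.indicator Φ) (μ.prod μ) := hΦ.indicator hD
  have i2 : Integrable (Dᶜ.indicator Φ) (μ.prod μ) := hΦ.indicator hD.compl
  rw [hE1, hE2, ← integral_integral_swap (f := fun s r => Dᶜ.indicator Φ (s, r)) i2,
    integral_integral (f := fun s r => D.indicator Φ (s, r)) i1,
    integral_integral (f := fun s r => Dᶜ.indicator Φ (s, r)) i2, ← integral_add i1 i2]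
  have e2 : ∀ p, D.indicator Φ p + Dᶜ.indicator Φ p = Φ p := fun p =>
    congrFun (indicator_self_add_compl D Φ) p
  simp only [e2]
  rw [integral_prod _ hΦ, intervalIntegral.integral_of_le hab, intervalIntegral.integral_of_le hab]
  simp only [Φ]
  have e3 : ∀ s, ∫ r, B (x' s) (y' r) ∂μ = B (x' s) (∫ r, y' r ∂μ) := fun s =>
    (B (x' s)).integral_comp_comm hy
  simp only [e3]
  exact (B.flip (∫ r, y' r ∂μ)).integral_comp_comm hx

/-- Integration by parts for two primitives of integrable functions. -/
lemma integral_bilin_by_parts (B : E →L[ℝ] F →L[ℝ] ℝ) {x x' : ℝ → E} {y y' : ℝ → F} {a b : ℝ}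
    (hab : a ≤ b) (hx' : IntervalIntegrable x' volume a b) (hy' : IntervalIntegrable y' volume a b)
    (hx : ∀ s ∈ Icc a b, x s = x a + ∫ r in a..s, x' r)
    (hy : ∀ s ∈ Icc a b, y s = y a + ∫ r in a..s, y' r) :
    ∫ s in a..b, B (x' s) (y s)
      = B (x b) (y b) - B (x a) (y a) - ∫ s in a..b, B (x s) (y' s) := by
  have hX := continuousOn_primitive_Icc hab hx'
  have hY := continuousOn_primitive_Icc hab hy'
  have h1 : ∫ s in a..b, B (x' s) (y s)
      = B (∫ r in a..b, x' r) (y a) + ∫ s in a..b, B (x' s) (∫ r in a..s, y' r) := by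
    have : ∫ s in a..b, B (x' s) (y s)
        = ∫ s in a..b, (B (x' s) (y a) + B (x' s) (∫ r in a..s, y' r)) := by
      refine intervalIntegral.integral_congr fun s hs => ?_
      rw [uIcc_of_le hab] at hs
      rw [hy s hs, map_add]
    rw [this, intervalIntegral.integral_add
      (intervalIntegrable_bilin_left B hab hx' continuousOn_const)
      (intervalIntegrable_bilin_left B hab hx' hY)]
    congr 1
    exact (B.flip (y a)).intervalIntegral_comp_comm hx'
  have h2 : ∫ s in a..b, B (x s) (y' s)
      = B (x a) (∫ r in a..b, y' r) + ∫ s in a..b, B (∫ r in a..s, x' r) (y' s) := by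
    have : ∫ s in a..b, B (x s) (y' s)
        = ∫ s in a..b, (B (x a) (y' s) + B (∫ r in a..s, x' r) (y' s)) := by
      refine intervalIntegral.integral_congr fun s hs => ?_
      rw [uIcc_of_le hab] at hs
      rw [hx s hs, map_add, add_apply]
    rw [this, intervalIntegral.integral_add
      (intervalIntegrable_bilin_right B hab continuousOn_const hy')
      (intervalIntegrable_bilin_right B hab hX hy')]
    congr 1
    exact (B (x a)).intervalIntegral_comp_comm hy'
  have h3 := integral_bilin_primitive B hab hx' hy'
  have hb : b ∈ Icc a b := right_mem_Icc.2 hab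
  rw [h1, h2, hx b hb, hy b hb]
  simp only [map_add, add_apply]
  linarith

end ByParts

/-! ### Functions defined piecewise on the time intervals -/

section Piecewise

variable {X : Type*} [NormedAddCommGroup X]

/-- The function on `(t 0, t N]` that equals `F n` on the `n`-th interval. -/
def pw (t : ℕ → ℝ) (N : ℕ) (F : ℕ → ℝ → X) (s : ℝ) : X :=
  ∑ n ∈ Finset.Icc 1 N, (Ioc (t (n - 1)) (t n)).indicator (F n) s

variable {t : ℕ → ℝ} {N : ℕ}

lemma nodes_mono (ht : ∀ n < N, t n < t (n + 1)) {m n : ℕ} (hmn : m ≤ n) (hn : n ≤ N) :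
    t m ≤ t n := by
  induction n, hmn using Nat.le_induction with
  | base => exact le_rfl
  | succ k _ ih => exact (ih (by omega)).trans (ht k (by omega)).le

lemma step_pos (ht : ∀ n < N, t n < t (n + 1)) {n : ℕ} (h1 : 1 ≤ n) (hn : n ≤ N) :
    0 < step t n := by
  obtain ⟨k, rfl⟩ := Nat.exists_eq_add_of_le' h1
  simpa [step] using ht k (by omega)

lemma exists_interval {s : ℝ} (hs : s ∈ Ioc (t 0) (t N)) :
    ∃ n, 1 ≤ n ∧ n ≤ N ∧ s ∈ Ioc (t (n - 1)) (t n) := by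
  have hex : ∃ n, s ≤ t n := ⟨N, hs.2⟩
  classical
  refine ⟨Nat.find hex, ?_, Nat.find_min' hex hs.2, ?_, Nat.find_spec hex⟩
  · rw [Nat.one_le_iff_ne_zero]
    intro h
    have := Nat.find_spec hex
    rw [h] at this
    exact absurd hs.1 (not_lt.2 this)
  · have h0 : Nat.find hex ≠ 0 := by
      intro h
      have := Nat.find_spec hex
      rw [h] at this
      exact absurd hs.1 (not_lt.2 this)
    exact not_le.1 (Nat.find_min hex (by omega : Nat.find hex - 1 < Nat.find hex))

lemma pw_apply (ht : ∀ n < N, t n < t (n + 1)) (F : ℕ → ℝ → X) {n : ℕ} (h1 : 1 ≤ n) (hn : n ≤ N)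
    {s : ℝ} (hs : s ∈ Ioc (t (n - 1)) (t n)) : pw t N F s = F n s := by
  rw [pw, Finset.sum_eq_single n]
  · exact indicator_of_mem hs _
  · intro j hj hjn
    rw [Finset.mem_Icc] at hj
    refine indicator_of_notMem (fun h => ?_) _
    rcases lt_or_gt_of_ne hjn with h' | h'
    · exact absurd hs.1 (not_lt.2 (h.2.trans (nodes_mono ht (by omega) (by omega))))
    · exact absurd h.1 (not_lt.2 (hs.2.trans (nodes_mono ht (by omega) (by omega))))
  · intro h
    exact absurd (Finset.mem_Icc.2 ⟨h1, hn⟩) h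

lemma integrable_pw (F : ℕ → ℝ → X)
    (hF : ∀ n, 1 ≤ n → n ≤ N → IntegrableOn (F n) (Ioc (t (n - 1)) (t n))) :
    Integrable (pw t N F) := by
  refine integrable_finsetSum _ fun n hn => ?_
  rw [Finset.mem_Icc] at hn
  exact (integrable_indicator_iff measurableSet_Ioc).2 (hF n hn.1 hn.2)

lemma integrable_pw_of_continuous (F : ℕ → ℝ → X) (hF : ∀ n, Continuous (F n)) :
    Integrable (pw t N F) :=
  integrable_pw F fun n _ _ => (hF n).integrableOn_Ioc

variable [NormedSpace ℝ X]

lemma intervalIntegral_pw (ht : ∀ n < N, t n < t (n + 1)) (F : ℕ → ℝ → X) {n : ℕ} (h1 : 1 ≤ n)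
    (hn : n ≤ N) {s : ℝ} (hs : s ∈ Icc (t (n - 1)) (t n)) :
    ∫ r in (t (n - 1))..s, pw t N F r = ∫ r in (t (n - 1))..s, F n r := by
  rw [intervalIntegral.integral_of_le hs.1, intervalIntegral.integral_of_le hs.1]
  exact setIntegral_congr_fun measurableSet_Ioc fun r hr =>
    pw_apply ht F h1 hn ⟨hr.1, hr.2.trans hs.2⟩

lemma sum_integral_nodes {Y : Type*} [NormedAddCommGroup Y] [NormedSpace ℝ Y]
    (h : ℝ → Y) (N : ℕ)
    (hi : ∀ n, 1 ≤ n → n ≤ N → IntervalIntegrable h volume (t (n - 1)) (t n)) :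
    ∑ n ∈ Finset.Icc 1 N, ∫ s in (t (n - 1))..(t n), h s = ∫ s in (t 0)..(t N), h s := by
  induction N with
  | zero => simp
  | succ M ih =>
    rw [Finset.sum_Icc_succ_top (by omega), ih fun n h1 hn => hi n h1 (by omega)]
    refine intervalIntegral.integral_add_adjacent_intervals ?_ (by simpa using hi (M + 1) (by omega) le_rfl)
    clear ih
    induction M with
    | zero => simp
    | succ K ihK =>
      exact (ihK fun n h1 hn => hi n h1 (by omega)).trans (by simpa using hi (K + 1) (by omega) (by omega))

/-- The fundamental theorem of calculus for a continuous piecewise `C¹` function. -/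
lemma pw_eq_integral [CompleteSpace X] (ht : ∀ n < N, t n < t (n + 1)) (F F' : ℕ → ℝ → X)
    (hF : ∀ n, 1 ≤ n → n ≤ N → ∀ s, HasDerivAt (F n) (F' n s) s) (hF' : ∀ n, Continuous (F' n))
    (hglue : ∀ n, 1 ≤ n → n < N → F n (t n) = F (n + 1) (t n))
    {s : ℝ} (hs : s ∈ Ioc (t 0) (t N)) :
    pw t N F s = F 1 (t 0) + ∫ r in (t 0)..s, pw t N F' r := by
  have hint := integrable_pw_of_continuous (t := t) (N := N) F' hF'
  have hloc : ∀ n, 1 ≤ n → n ≤ N → ∀ s ∈ Icc (t (n - 1)) (t n),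
      F n s = F n (t (n - 1)) + ∫ r in (t (n - 1))..s, pw t N F' r := by
    intro n h1 hn s hs
    rw [intervalIntegral_pw ht F' h1 hn hs,
      intervalIntegral.integral_eq_sub_of_hasDerivAt (fun r _ => hF n h1 hn r)
        ((hF' n).intervalIntegrable _ _)]
    abel
  have key : ∀ n, 1 ≤ n → n ≤ N → ∀ s ∈ Icc (t (n - 1)) (t n),
      F n s = F 1 (t 0) + ∫ r in (t 0)..s, pw t N F' r := by
    intro n h1
    induction n, h1 using Nat.le_induction with
    | base => exact fun hn s hs => hloc 1 le_rfl hn s hs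
    | succ k hk ih =>
      intro hn s hs
      rw [hloc (k + 1) (by omega) hn s hs, Nat.add_sub_cancel, ← hglue k hk (by omega),
        ih (by omega) (t k) ⟨nodes_mono ht (by omega) (by omega), le_rfl⟩, add_assoc,
        intervalIntegral.integral_add_adjacent_intervals hint.intervalIntegrable
          hint.intervalIntegrable]
  obtain ⟨n, h1, hn, hs'⟩ := exists_interval hs
  rw [pw_apply ht F h1 hn hs']
  exact key n h1 hn s (Ioc_subset_Icc_self hs')

/-- The points of `(t 0, t N]` which are not in the interior of an interval form a null set. -/
lemma ae_exists_Ioo :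
    ∀ᵐ s ∂(volume.restrict (Ioc (t 0) (t N))),
      ∃ n, 1 ≤ n ∧ n ≤ N ∧ s ∈ Ioo (t (n - 1)) (t n) := by
  have h0 : ∀ᵐ s : ℝ, s ∉ t '' (Set.Iic N) :=
    (((Set.finite_Iic N).image t).countable.ae_notMem volume)
  filter_upwards [ae_restrict_of_ae h0, ae_restrict_mem measurableSet_Ioc] with s hs hs'
  obtain ⟨n, h1, hn, hm⟩ := exists_interval hs'
  exact ⟨n, h1, hn, hm.1, lt_of_le_of_ne hm.2 fun h => hs ⟨n, hn, h.symm⟩⟩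

end Piecewise

/-! ### The regularised dual problem and its conserved energies -/

section Dual

variable {H X : Type*} [NormedAddCommGroup H] [InnerProductSpace ℝ H] [CompleteSpace H]
  [NormedAddCommGroup X] [InnerProductSpace ℝ X]

/-- The inner product as a continuous bilinear map. -/
def ip (X : Type*) [NormedAddCommGroup X] [InnerProductSpace ℝ X] : X →L[ℝ] X →L[ℝ] ℝ :=
  (innerₗ X).mkContinuous₂ 1 fun x y => by simpa using abs_real_inner_le_norm x y

@[simp] lemma ip_apply {X : Type*} [NormedAddCommGroup X] [InnerProductSpace ℝ X] (x y : X) :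
    ip X x y = ⟪x, y⟫ := rfl

/-- The form `⟨J z, J v⟩ + δ b(z, v)`. -/
def regForm (J : H →L[ℝ] X) (b : H →L[ℝ] H →L[ℝ] ℝ) (δ : ℝ) : H →L[ℝ] H →L[ℝ] ℝ :=
  (ip X).bilinearComp J J + δ • b

omit [CompleteSpace H] in
lemma regForm_apply (J : H →L[ℝ] X) (b : H →L[ℝ] H →L[ℝ] ℝ) (δ : ℝ) (z v : H) :
    regForm J b δ z v = ⟪J z, J v⟫ + δ * b z v := by
  simp [regForm]

/-- A regularised evolution operator: `⟨J S z, J v⟩ + δ b(S z, v) = -b(z, v)`. -/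
lemma exists_regOp (J : H →L[ℝ] X) (b : H →L[ℝ] H →L[ℝ] ℝ) {c δ : ℝ} (hc : 0 < c)
    (hb : ∀ v, c * ‖v‖ ^ 2 ≤ c * ‖J v‖ ^ 2 + b v v) (hδ : 0 < δ) (hδc : δ * c ≤ 1) :
    ∃ S : H →L[ℝ] H, ∀ z v, regForm J b δ (S z) v = -b z v := by
  have hco : IsCoercive (regForm J b δ) := by
    -- The Gårding-type bound `hb` loses c‖Jv‖²; after multiplication by δ this loss is absorbed by
    -- ‖Jv‖² exactly because δc ≤ 1.
    refine ⟨δ * c, by positivity, fun v => ?_⟩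
    rw [regForm_apply, real_inner_self_eq_norm_sq]
    nlinarith [hb v, mul_nonneg (sub_nonneg.2 hδc) (sq_nonneg ‖J v‖),
      mul_le_mul_of_nonneg_left (hb v) hδ.le]
  let A : H →L[ℝ] H := InnerProductSpace.continuousLinearMapOfBilin (𝕜 := ℝ) b
  let E := hco.continuousLinearEquivOfBilin
  refine ⟨-((E.symm : H →L[ℝ] H).comp A), fun z v => ?_⟩
  have h1 : ⟪E (E.symm (A z)), v⟫ = regForm J b δ (E.symm (A z)) v :=
    hco.continuousLinearEquivOfBilin_apply _ _
  rw [E.apply_symm_apply] at h1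
  have h2 : ⟪A z, v⟫ = b z v := InnerProductSpace.continuousLinearMapOfBilin_apply b z v
  simp [← h1, h2]

/-- Solutions of linear evolution equations with a bounded operator. -/
lemma exists_firstOrder {Y : Type*} [NormedAddCommGroup Y] [NormedSpace ℝ Y] [CompleteSpace Y]
    (Λ : Y →L[ℝ] Y) (τ : ℝ) (y : Y) :
    ∃ Z : ℝ → Y, (∀ s, HasDerivAt Z (Λ (Z s)) s) ∧ Z τ = y := by
  refine ⟨fun s => NormedSpace.exp ((s - τ) • Λ) y, fun s => ?_, by simp⟩
  have h1 : HasDerivAt (fun s : ℝ => NormedSpace.exp ((s - τ) • Λ))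
      (Λ * NormedSpace.exp ((s - τ) • Λ)) s := by
    have := (hasDerivAt_exp_smul_const' (𝕂 := ℝ) Λ (s - τ)).scomp s
      ((hasDerivAt_id s).sub_const τ)
    rw [one_smul] at this
    exact this
  simpa using h1.clm_apply (hasDerivAt_const s y)

/-- Solutions of the linear second order equation with a bounded operator. -/
lemma exists_secondOrder (S : H →L[ℝ] H) (τ : ℝ) (z₁ : H) :
    ∃ z z' : ℝ → H, (∀ s, HasDerivAt z (z' s) s) ∧ (∀ s, HasDerivAt z' (S (z s)) s) ∧
      z τ = 0 ∧ z' τ = z₁ := by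
  obtain ⟨Z, hZ, h0⟩ := exists_firstOrder
    ((ContinuousLinearMap.snd ℝ H H).prod (S.comp (ContinuousLinearMap.fst ℝ H H))) τ
    ((0 : H), z₁)
  refine ⟨fun s => (Z s).1, fun s => (Z s).2, fun s => ?_, fun s => ?_, ?_, ?_⟩
  · exact (hZ s).fst
  · exact (hZ s).snd
  · simp [h0]
  · simp [h0]

-- By symmetry the derivative of the energy is twice `regForm (S z) z' + b z z'`, which vanishes by
-- the equation for `S`.
omit [CompleteSpace H] in
lemma regForm_energy (J : H →L[ℝ] X) (b : H →L[ℝ] H →L[ℝ] ℝ) (hs : ∀ z v, b z v = b v z) (δ : ℝ)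
    {S : H →L[ℝ] H} (hS : ∀ z v, regForm J b δ (S z) v = -b z v) {z z' : ℝ → H}
    (hz : ∀ s, HasDerivAt z (z' s) s) (hz' : ∀ s, HasDerivAt z' (S (z s)) s) (s r : ℝ) :
    regForm J b δ (z' s) (z' s) + b (z s) (z s) = regForm J b δ (z' r) (z' r) + b (z r) (z r) := by
  have hd : ∀ s, HasDerivAt (fun s => regForm J b δ (z' s) (z' s) + b (z s) (z s)) 0 s := by
    intro s
    have h1 := ((regForm J b δ).hasFDerivAt.comp_hasDerivAt s (hz' s)).clm_apply (hz' s)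
    have h2 := (b.hasFDerivAt.comp_hasDerivAt s (hz s)).clm_apply (hz s)
    refine (h1.add h2).congr_deriv ?_
    have h3 : regForm J b δ (z' s) (S (z s)) = regForm J b δ (S (z s)) (z' s) := by
      rw [regForm_apply, regForm_apply, real_inner_comm, hs]
    simp only [Function.comp_apply]
    rw [h3, hS, hs (z' s) (z s)]
    ring
  exact is_const_of_deriv_eq_zero (fun s => (hd s).differentiableAt) (fun s => (hd s).deriv) s r

/-- The regularised dual problem, solved backwards from `z(τ) = 0`, `z'(τ) = -φ`. -/
lemma exists_dual (J : H →L[ℝ] X) (b : H →L[ℝ] H →L[ℝ] ℝ) (hs : ∀ z v, b z v = b v z)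
    (hb0 : ∀ v, 0 ≤ b v v) {c δ : ℝ} (hc : 0 < c)
    (hb : ∀ v, c * ‖v‖ ^ 2 ≤ c * ‖J v‖ ^ 2 + b v v) (hδ : 0 < δ) (hδc : δ * c ≤ 1) (τ : ℝ) (φ : H) :
    ∃ z z' z'' : ℝ → H, (∀ s, HasDerivAt z (z' s) s) ∧ (∀ s, HasDerivAt z' (z'' s) s) ∧
      Continuous z'' ∧ z τ = 0 ∧ z' τ = -φ ∧
      (∀ s v, ⟪J (z'' s), J v⟫ + δ * b (z'' s) v = -b (z s) v) ∧
      (∀ s, ‖J (z' s)‖ ^ 2 ≤ ‖J φ‖ ^ 2 + δ * b φ φ) ∧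
      (∀ s, b (z s) (z s) ≤ ‖J φ‖ ^ 2 + δ * b φ φ) ∧ (∀ s, δ * b (z'' s) (z'' s) ≤ b φ φ) := by
  obtain ⟨S, hS⟩ := exists_regOp J b hc hb hδ hδc
  obtain ⟨z, z', hz, hz', h0, h1⟩ := exists_secondOrder S τ (-φ)
  -- The derivative z' solves the same equation, so it has a conserved energy of its own. At τ that
  -- energy is b(φ, φ), since z''(τ) = S 0 = 0; this is what controls δ b(z'', z'') uniformly in δ.
  have hz'' : ∀ s, HasDerivAt (fun s => S (z s)) (S (z' s)) s := fun s =>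
    S.hasFDerivAt.comp_hasDerivAt s (hz s)
  have E1 := fun s => regForm_energy J b hs δ hS hz hz' s τ
  have E2 := fun s => regForm_energy J b hs δ hS hz' hz'' s τ
  simp only [regForm_apply, h0, h1, map_neg, map_zero, real_inner_self_eq_norm_sq, neg_apply,
    neg_neg] at E1 E2
  refine ⟨z, z', fun s => S (z s), hz, hz',
    S.continuous.comp (continuous_iff_continuousAt.2 fun s => (hz s).continuousAt), h0, h1,
    fun s v => by rw [← regForm_apply, hS], fun s => ?_, fun s => ?_, fun s => ?_⟩
  · nlinarith [E1 s, hb0 (z s), mul_nonneg hδ.le (hb0 (z' s))]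
  · nlinarith [E1 s, sq_nonneg ‖J (z' s)‖, mul_nonneg hδ.le (hb0 (z' s))]
  · nlinarith [E2 s, sq_nonneg ‖J (S (z s))‖, hb0 (z' s)]

end Dual

/-! ### The Poincaré–Friedrichs inequality -/

section Spaces

variable {d : ℕ} {Ω : Set (EuclideanSpace ℝ (Fin d))}

lemma norm_sq_eq_incl_add_grad (v : H10 Ω) : ‖v‖ ^ 2 = ‖incl Ω v‖ ^ 2 + ‖grad Ω v‖ ^ 2 := by
  have h := WithLp.prod_norm_sq_eq_of_L2 (v : WithLp 2 (L2 Ω × L2vec Ω))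
  simpa [incl, grad] using h

lemma Lp_norm_sq_eq_integral {E : Type*} [NormedAddCommGroup E] [InnerProductSpace ℝ E]
    {α : Type*} [MeasurableSpace α] {μ : Measure α} (F : Lp E 2 μ) :
    ‖F‖ ^ 2 = ∫ x, ‖F x‖ ^ 2 ∂μ := by
  rw [← real_inner_self_eq_norm_sq, L2.inner_def]
  simp only [real_inner_self_eq_norm_sq]

/-- With ℓ the first coordinate, ∫φ² = -∫ ℓ ∂₁(φ²), and |ℓ| ≤ R on the support of φ. -/
lemma integral_sq_le_of_contDiff (hd : 0 < d) {R : ℝ}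
    {φ : EuclideanSpace ℝ (Fin d) → ℝ} (hφ : ContDiff ℝ ∞ φ) (hc : HasCompactSupport φ)
    (hR : ∀ x ∈ tsupport φ, ‖x‖ ≤ R) :
    ∫ x, φ x ^ 2 ≤ 4 * R ^ 2 * ∫ x, ‖gradient φ x‖ ^ 2 := by
  let i : Fin d := ⟨0, hd⟩
  let v : EuclideanSpace ℝ (Fin d) := EuclideanSpace.single i 1
  have hv : ‖v‖ = 1 := by simp [v]
  let ℓ : EuclideanSpace ℝ (Fin d) →L[ℝ] ℝ := innerSL ℝ v
  have hℓv : ℓ v = 1 := by simp [ℓ, hv]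
  have hℓ : ∀ x, |ℓ x| ≤ ‖x‖ := fun x => by
    have := abs_real_inner_le_norm v x
    rwa [hv, one_mul] at this
  have hdiff : Differentiable ℝ φ := hφ.differentiable (by simp)
  have hfd : ∀ x, fderiv ℝ (fun x => φ x ^ 2) x v = 2 * φ x * fderiv ℝ φ x v := by
    intro x
    rw [fderiv_fun_pow 2 (hdiff x)]
    simp
  have hcφ : Continuous φ := hφ.continuous
  have hcd : Continuous (fderiv ℝ φ) := hφ.continuous_fderiv (by simp)
  have hcdv : Continuous fun x => fderiv ℝ φ x v := hcd.clm_apply continuous_const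
  have hgr : Continuous (gradient φ) :=
    (InnerProductSpace.toDual ℝ _).symm.continuous.comp hcd
  have hsq : HasCompactSupport fun x => φ x ^ 2 := by
    simp only [sq]
    exact hc.mul_left (f' := φ)
  have i1 : Integrable fun x => φ x ^ 2 := (hcφ.pow 2).integrable_of_hasCompactSupport hsq
  have i2 : Integrable fun x => ℓ x * fderiv ℝ (fun x => φ x ^ 2) x v := by
    simp only [hfd]
    refine Continuous.integrable_of_hasCompactSupport
      (ℓ.continuous.mul ((continuous_const.mul hcφ).mul hcdv)) ?_
    exact ((hc.mul_left (f := fun _ => 2)).mul_right).mul_left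
  have i3 : Integrable fun x => fderiv ℝ ℓ x v * φ x ^ 2 := by
    simpa [hℓv] using i1
  have i4 : Integrable fun x => ℓ x * φ x ^ 2 :=
    (ℓ.continuous.mul (hcφ.pow 2)).integrable_of_hasCompactSupport hsq.mul_left
  have i5 : Integrable fun x => ‖gradient φ x‖ ^ 2 := by
    refine (hgr.norm.pow 2).integrable_of_hasCompactSupport (hc.mono' ?_)
    intro x hx
    by_contra hx'
    refine hx ?_
    have : fderiv ℝ φ x = 0 := by
      by_contra h
      exact hx' (support_fderiv_subset ℝ h)
    simp [gradient, this]
  have hparts := integral_mul_fderiv_eq_neg_fderiv_mul_of_integrable (μ := volume)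
    (f := ℓ) (g := fun x => φ x ^ 2) (v := v) i3 i2 i4 (fun x _ => ℓ.differentiableAt)
    (fun x _ => (hdiff x).pow 2)
  have e1 : ∫ x, fderiv ℝ ℓ x v * φ x ^ 2 = ∫ x, φ x ^ 2 := by simp [hℓv]
  -- Young's inequality for 2|φ||ℓ ∂₁φ|, with weight 1/2 on φ² so that this term can be absorbed on
  -- the left.
  have hpt : ∀ x, -(ℓ x * fderiv ℝ (fun x => φ x ^ 2) x v)
      ≤ (1 / 2) * φ x ^ 2 + 2 * R ^ 2 * ‖gradient φ x‖ ^ 2 := by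
    intro x
    rw [hfd]
    have h2 : (fderiv ℝ φ x v) ^ 2 ≤ ‖gradient φ x‖ ^ 2 := by
      have h3 : fderiv ℝ φ x v = ⟪gradient φ x, v⟫ := by
        simp [gradient]
      have h4 := abs_real_inner_le_norm (gradient φ x) v
      rw [hv, mul_one, ← h3] at h4
      rw [← sq_abs]
      exact pow_le_pow_left₀ (abs_nonneg _) h4 2
    by_cases hx : x ∈ tsupport φ
    · have h5 : (ℓ x) ^ 2 ≤ R ^ 2 :=
        sq_le_sq' (by linarith [abs_le.1 ((hℓ x).trans (hR x hx))])
          (abs_le.1 ((hℓ x).trans (hR x hx))).2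
      nlinarith [sq_nonneg (φ x + 2 * (ℓ x * fderiv ℝ φ x v)),
        mul_le_mul h5 h2 (sq_nonneg _) (sq_nonneg _)]
    · rw [image_eq_zero_of_notMem_tsupport hx]
      have : 0 ≤ 2 * R ^ 2 * ‖gradient φ x‖ ^ 2 := by positivity
      simpa using this
  have hint := integral_mono i2.neg ((i1.const_mul (1 / 2)).add (i5.const_mul (2 * R ^ 2))) hpt
  simp only [Pi.neg_apply, Pi.add_apply] at hint
  rw [integral_neg, integral_add (i1.const_mul _) (i5.const_mul _), integral_const_mul,
    integral_const_mul, hparts, e1] at hint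
  linarith

/-- The Poincaré–Friedrichs inequality on a bounded domain. -/
lemma exists_poincare (hd : 0 < d) (hΩb : Bornology.IsBounded Ω) :
    ∃ C : ℝ, 0 ≤ C ∧ ∀ v : H10 Ω, ‖incl Ω v‖ ^ 2 ≤ C * ‖grad Ω v‖ ^ 2 := by
  obtain ⟨R, hR⟩ := hΩb.exists_norm_le
  refine ⟨4 * R ^ 2, by positivity, fun v => ?_⟩
  -- The inequality is a closed condition on pairs (v, ∇v), so it passes from test functions to
  -- their closure.
  have hcl : IsClosed {p : WithLp 2 (L2 Ω × L2vec Ω) | ‖p.fst‖ ^ 2 ≤ 4 * R ^ 2 * ‖p.snd‖ ^ 2} := by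
    refine isClosed_le ?_ ?_
    · exact (WithLp.fstL 2 ℝ (L2 Ω) (L2vec Ω)).continuous.norm.pow 2
    · exact continuous_const.mul ((WithLp.sndL 2 ℝ (L2 Ω) (L2vec Ω)).continuous.norm.pow 2)
  have hsub : (testGraph Ω : Set (WithLp 2 (L2 Ω × L2vec Ω)))
      ⊆ {p | ‖p.fst‖ ^ 2 ≤ 4 * R ^ 2 * ‖p.snd‖ ^ 2} := by
    rintro p ⟨φ, hφ, hφc, hφs, h1, h2⟩
    have key := integral_sq_le_of_contDiff hd hφ hφc fun x hx => hR x (hφs hx)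
    have hz : ∀ x ∉ Ω, fderiv ℝ φ x = 0 := fun x hx => by
      by_contra h
      exact hx (hφs (support_fderiv_subset ℝ h))
    rw [mem_ofPred_eq, Lp_norm_sq_eq_integral, Lp_norm_sq_eq_integral]
    have e1 : ∫ x in Ω, ‖p.fst x‖ ^ 2 = ∫ x, φ x ^ 2 := by
      rw [← setIntegral_eq_integral_of_forall_compl_eq_zero (s := Ω) (f := fun x => φ x ^ 2)]
      · refine integral_congr_ae ?_
        filter_upwards [h1] with x hx
        rw [hx, Real.norm_eq_abs, sq_abs]
      · intro x hx
        simp [image_eq_zero_of_notMem_tsupport fun h => hx (hφs h)]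
    have e2 : ∫ x in Ω, ‖p.snd x‖ ^ 2 = ∫ x, ‖gradient φ x‖ ^ 2 := by
      rw [← setIntegral_eq_integral_of_forall_compl_eq_zero (s := Ω)
        (f := fun x => ‖gradient φ x‖ ^ 2)]
      · refine integral_congr_ae ?_
        filter_upwards [h2] with x hx
        rw [hx]
      · intro x hx
        simp [gradient, hz x hx]
    rw [e1, e2]
    exact key
  exact closure_minimal hsub hcl v.2

/-- The infimum is itself admissible: where ∇v ≠ 0 every admissible constant dominates the quotient
‖v‖²/‖∇v‖², and where ∇v = 0 any one of them forces v = 0 in L². -/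
lemma incl_sq_le_poincareConst (hd : 0 < d) (hΩb : Bornology.IsBounded Ω) (v : H10 Ω) :
    ‖incl Ω v‖ ^ 2 ≤ poincareConst Ω * ‖grad Ω v‖ ^ 2 := by
  obtain ⟨C, hC0, hC⟩ := exists_poincare hd hΩb
  rcases (sq_nonneg ‖grad Ω v‖).eq_or_lt with h | h
  · have := hC v
    rw [← h] at this ⊢
    simpa using this
  · rw [← div_le_iff₀ h]
    exact le_csInf ⟨C, hC0, hC⟩ fun K hK => (div_le_iff₀ h).2 (hK.2 v)

lemma poincareConst_nonneg : 0 ≤ poincareConst Ω :=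
  Real.sInf_nonneg fun _ hC => hC.1

end Spaces

/-! ### The elliptic form as a bounded, coercive bilinear form -/

section Form

variable {d : ℕ} {Ω : Set (EuclideanSpace ℝ (Fin d))} {a : EuclideanSpace ℝ (Fin d) → ℝ}

lemma memLp_coeff_smul {K : ℝ} (ham : AEStronglyMeasurable a (volume.restrict Ω))
    (haK : ∀ᵐ x ∂(volume.restrict Ω), |a x| ≤ K) (G : L2vec Ω) :
    MemLp (fun x => a x • G x) 2 (volume.restrict Ω) := by
  refine (Lp.memLp G).of_le_mul (c := K) (ham.smul (Lp.aestronglyMeasurable G)) ?_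
  filter_upwards [haK] with x hx
  rw [norm_smul, Real.norm_eq_abs]
  exact mul_le_mul_of_nonneg_right hx (norm_nonneg _)

lemma aForm_eq_inner {K : ℝ} (ham : AEStronglyMeasurable a (volume.restrict Ω))
    (haK : ∀ᵐ x ∂(volume.restrict Ω), |a x| ≤ K) (z v : H10 Ω) :
    aForm a z v = ⟪(memLp_coeff_smul ham haK (grad Ω z)).toLp _, grad Ω v⟫ := by
  rw [aForm, L2.inner_def]
  refine integral_congr_ae ?_
  filter_upwards [(memLp_coeff_smul ham haK (grad Ω z)).coeFn_toLp] with x hx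
  rw [hx, real_inner_smul_left]

lemma aForm_comm (z v : H10 Ω) : aForm a z v = aForm a v z := by
  refine integral_congr_ae (ae_of_all _ fun x => ?_)
  simp only
  rw [real_inner_comm]

/-- The bilinear form `a(·, ·)` is bounded on `H¹₀(Ω)`. -/
lemma exists_aForm_bilin {K : ℝ} (ham : AEStronglyMeasurable a (volume.restrict Ω))
    (haK : ∀ᵐ x ∂(volume.restrict Ω), |a x| ≤ K) :
    ∃ b : H10 Ω →L[ℝ] H10 Ω →L[ℝ] ℝ, ∀ z v, b z v = aForm a z v := by
  have hadd : ∀ z v v' : H10 Ω, aForm a z (v + v') = aForm a z v + aForm a z v' := fun z v v' => by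
    simp only [aForm_eq_inner ham haK, map_add, inner_add_right]
  have hsmul : ∀ (c : ℝ) (z v : H10 Ω), aForm a z (c • v) = c * aForm a z v := fun c z v => by
    simp only [aForm_eq_inner ham haK, map_smul, real_inner_smul_right]
  have hgrad : ∀ v : H10 Ω, ‖grad Ω v‖ ≤ ‖v‖ := fun v => by
    refine abs_le_of_sq_le_sq' ?_ (norm_nonneg _) |>.2
    rw [norm_sq_eq_incl_add_grad]
    linarith [sq_nonneg ‖incl Ω v‖]
  let b₀ : H10 Ω →ₗ[ℝ] H10 Ω →ₗ[ℝ] ℝ := LinearMap.mk₂ ℝ (aForm a)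
    (fun z z' v => by rw [aForm_comm, hadd, aForm_comm v, aForm_comm v])
    (fun c z v => by rw [aForm_comm, hsmul, aForm_comm v, smul_eq_mul])
    hadd (fun c z v => by rw [hsmul, smul_eq_mul])
  refine ⟨b₀.mkContinuous₂ |K| fun z v => ?_, fun z v => rfl⟩
  change |aForm a z v| ≤ _
  rw [aForm_eq_inner ham haK]
  refine (abs_real_inner_le_norm _ _).trans ?_
  refine mul_le_mul ?_ (hgrad v) (norm_nonneg _) (by positivity)
  refine (Lp.norm_le_mul_norm_of_ae_le_mul (c := |K|) (g := grad Ω z) ?_).trans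
    (mul_le_mul_of_nonneg_left (hgrad z) (abs_nonneg _))
  filter_upwards [(memLp_coeff_smul ham haK (grad Ω z)).coeFn_toLp, haK] with x hx hK
  rw [hx, norm_smul, Real.norm_eq_abs]
  exact mul_le_mul_of_nonneg_right (hK.trans (le_abs_self K)) (norm_nonneg _)

lemma mul_grad_sq_le_aForm {α K : ℝ} (ham : AEStronglyMeasurable a (volume.restrict Ω))
    (haK : ∀ᵐ x ∂(volume.restrict Ω), |a x| ≤ K)
    (haα : ∀ᵐ x ∂(volume.restrict Ω), α ≤ a x) (v : H10 Ω) :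
    α * ‖grad Ω v‖ ^ 2 ≤ aForm a v v := by
  rw [Lp_norm_sq_eq_integral, aForm, ← integral_const_mul]
  refine integral_mono_ae ?_ ?_ ?_
  · exact ((memLp_two_iff_integrable_sq_norm (Lp.aestronglyMeasurable _)).1
      (Lp.memLp (grad Ω v))).const_mul α
  · have := L2.integrable_inner (𝕜 := ℝ) ((memLp_coeff_smul ham haK (grad Ω v)).toLp _) (grad Ω v)
    refine this.congr ?_
    filter_upwards [(memLp_coeff_smul ham haK (grad Ω v)).coeFn_toLp] with x hx
    rw [hx, real_inner_smul_left]
  · filter_upwards [haα] with x hx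
    rw [real_inner_self_eq_norm_sq]
    exact mul_le_mul_of_nonneg_right hx (sq_nonneg _)

end Form

/-! ### Stability by duality -/

section Stability

variable {H X : Type*} [NormedAddCommGroup H] [InnerProductSpace ℝ H] [CompleteSpace H]
  [NormedAddCommGroup X] [InnerProductSpace ℝ X] [CompleteSpace X]

/-- `ζ` is a primitive of `ζ'` on `[0, T]`, `‖ζ'‖ ≤ κ` and `ζ(T) = 0`. -/
structure IsTest (T κ : ℝ) (ζ ζ' : ℝ → X) : Prop where
  integrable : IntervalIntegrable ζ' volume 0 T
  eq_integral : ∀ s ∈ Icc 0 T, ζ s = ζ 0 + ∫ r in (0 : ℝ)..s, ζ' r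
  norm_le : ∀ s, ‖ζ' s‖ ≤ κ
  final : ζ T = 0

omit [CompleteSpace H] in
/-- The solution of the dual problem, continued by zero after the time `τ`. -/
lemma isTest_dual (J : H →L[ℝ] X) {T τ κ : ℝ} (hτ : τ ∈ Ioc 0 T) {z z' : ℝ → H}
    (hz : ∀ s, HasDerivAt z (z' s) s) (hz' : Continuous z') (h0 : z τ = 0) (hκ : 0 ≤ κ)
    (hb : ∀ s, ‖J (z' s)‖ ≤ κ) :
    IsTest T κ (fun s => J (z (min s τ))) ({s | s ≤ τ}.indicator fun s => J (z' s)) := by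
  have hc : Continuous fun s => J (z' s) := J.continuous.comp hz'
  have hd : ∀ s, HasDerivAt (fun s => J (z s)) (J (z' s)) s := fun s =>
    J.hasFDerivAt.comp_hasDerivAt s (hz s)
  have hi : ∀ a b, IntervalIntegrable ({s | s ≤ τ}.indicator fun s => J (z' s)) volume a b := by
    intro a b
    rw [intervalIntegrable_iff]
    exact (intervalIntegrable_iff.1 (hc.intervalIntegrable a b)).indicator measurableSet_Iic
  have hτ0 : min 0 τ = 0 := min_eq_left hτ.1.le
  refine ⟨hi _ _, fun s hs => ?_, fun s => ?_, ?_⟩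
  · simp only [hτ0]
    have hftc : ∀ s, ∫ r in (0 : ℝ)..s, J (z' r) = J (z s) - J (z 0) := fun s =>
      intervalIntegral.integral_eq_sub_of_hasDerivAt (fun r _ => hd r) (hc.intervalIntegrable _ _)
    rcases le_total s τ with h | h
    · have : ∫ r in (0 : ℝ)..s, {s | s ≤ τ}.indicator (fun s => J (z' s)) r
          = ∫ r in (0 : ℝ)..s, J (z' r) := by
        refine intervalIntegral.integral_congr fun r hr => ?_
        rw [uIcc_of_le hs.1] at hr
        exact indicator_of_mem (show r ∈ {s | s ≤ τ} from hr.2.trans h) _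
      rw [this, hftc, min_eq_left h]
      abel
    · rw [intervalIntegral.integral_indicator ⟨hτ.1.le, h⟩, hftc, min_eq_right h]
      abel
  · rw [indicator_apply]
    split_ifs
    · exact hb s
    · simpa using hκ
  · simp only [min_eq_right hτ.2, h0, map_zero]

/-- The dual representation of the value at time `τ` of the solution of a wave equation. -/
lemma dual_representation (J : H →L[ℝ] X) (b : H →L[ℝ] H →L[ℝ] ℝ) (hs : ∀ z v, b z v = b v z)
    {T : ℝ} {ρ : ℝ → H} (hρ : IntervalIntegrable ρ volume 0 T)
    {q ε' R : ℝ → X} {e'' : ℝ → StrongDual ℝ H} (hqi : IntervalIntegrable q volume 0 T)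
    (hεi : IntervalIntegrable ε' volume 0 T) (hRi : IntervalIntegrable R volume 0 T)
    (hei : IntervalIntegrable e'' volume 0 T) {r₀ e₁ : X}
    (hr : ∀ᵐ s ∂(volume.restrict (Ioc 0 T)), J (ρ s) = r₀ + ∫ r in (0 : ℝ)..s, (q r + ε' r))
    (hq : ∀ᵐ s ∂(volume.restrict (Ioc 0 T)),
      (innerSL ℝ (q s)).comp J = (innerSL ℝ e₁).comp J + ∫ r in (0 : ℝ)..s, e'' r)
    (heq : ∀ᵐ s ∂(volume.restrict (Ioc 0 T)), ∀ v, e'' s v + b (ρ s) v = ⟪R s, J v⟫)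
    {τ δ : ℝ} (hτ : τ ∈ Ioc 0 T) {φ : H} {z z' z'' : ℝ → H}
    (hz : ∀ s, HasDerivAt z (z' s) s) (hz' : ∀ s, HasDerivAt z' (z'' s) s)
    (hz'' : Continuous z'') (hz0 : z τ = 0) (hz1 : z' τ = -φ)
    (hdual : ∀ s v, ⟪J (z'' s), J v⟫ + δ * b (z'' s) v = -b (z s) v) :
    ⟪r₀ + ∫ r in (0 : ℝ)..τ, (q r + ε' r), J φ⟫
      = ⟪e₁, J (z 0)⟫ - ⟪r₀, J (z' 0)⟫ - (∫ s in (0 : ℝ)..τ, ⟪ε' s, J (z' s)⟫)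
        + (∫ s in (0 : ℝ)..τ, δ * b (z'' s) (ρ s)) + ∫ s in (0 : ℝ)..τ, ⟪R s, J (z s)⟫ := by
  have h0τ : (0 : ℝ) ≤ τ := hτ.1.le
  have hsub : uIcc 0 τ ⊆ uIcc 0 T := by
    rw [uIcc_of_le h0τ, uIcc_of_le (h0τ.trans hτ.2)]
    exact Icc_subset_Icc_right hτ.2
  have hτρ := hρ.mono_set hsub
  have hτq := hqi.mono_set hsub
  have hτε := hεi.mono_set hsub
  have hτR := hRi.mono_set hsub
  have hτe := hei.mono_set hsub
  have hcz : Continuous z := continuous_iff_continuousAt.2 fun s => (hz s).continuousAt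
  have hcz' : Continuous z' := continuous_iff_continuousAt.2 fun s => (hz' s).continuousAt
  have hmeas : volume.restrict (Ioc 0 τ) ≤ volume.restrict (Ioc 0 T) :=
    Measure.restrict_mono (Ioc_subset_Ioc_right hτ.2) le_rfl
  have hae : ∀ {p : ℝ → Prop}, (∀ᵐ s ∂(volume.restrict (Ioc 0 T)), p s) →
      ∀ᵐ s, s ∈ Set.uIoc 0 τ → p s := by
    intro p hp
    rw [uIoc_of_le h0τ]
    exact (ae_restrict_iff' measurableSet_Ioc).1 (ae_mono hmeas hp)
  -- first integration by parts, in the duality of `H` and its dual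
  have hP := integral_bilin_by_parts (ContinuousLinearMap.id ℝ (StrongDual ℝ H)) h0τ hτe
    (hcz'.intervalIntegrable 0 τ)
    (x := fun s => (innerSL ℝ e₁).comp J + ∫ r in (0 : ℝ)..s, e'' r) (y := z)
    (fun s _ => by simp)
    (fun s _ => by
      rw [intervalIntegral.integral_eq_sub_of_hasDerivAt (fun r _ => hz r)
        (hcz'.intervalIntegrable _ _)]
      abel)
  have hP2 : ∫ s in (0 : ℝ)..τ, ((innerSL ℝ e₁).comp J + ∫ r in (0 : ℝ)..s, e'' r) (z' s)
      = ∫ s in (0 : ℝ)..τ, ⟪q s, J (z' s)⟫ := by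
    refine intervalIntegral.integral_congr_ae ?_
    filter_upwards [hae hq] with s hs hsτ
    rw [← hs hsτ]
    rfl
  -- second integration by parts, in `X`
  have hS := integral_bilin_by_parts (ip X) h0τ (hτq.add hτε)
    (((J.continuous.comp hz'').intervalIntegrable 0 τ))
    (x := fun s => r₀ + ∫ r in (0 : ℝ)..s, (q r + ε' r)) (y := fun s => J (z' s))
    (fun s _ => by simp)
    (fun s _ => by
      have := intervalIntegral.integral_eq_sub_of_hasDerivAt
        (fun r _ => J.hasFDerivAt.comp_hasDerivAt r (hz' r))
        ((J.continuous.comp hz'').intervalIntegrable 0 s)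
      simp only [Function.comp_apply] at this ⊢
      rw [this]
      abel)
  -- The dual equation tested with v = ρ(s), which lies in H for every s. The form b(z, ρ) produced
  -- here cancels the one in `hE`.
  have hS2 : ∫ s in (0 : ℝ)..τ, ip X (r₀ + ∫ r in (0 : ℝ)..s, (q r + ε' r)) ((J ∘ z'') s)
      = -(∫ s in (0 : ℝ)..τ, b (z s) (ρ s)) - ∫ s in (0 : ℝ)..τ, δ * b (z'' s) (ρ s) := by
    rw [← intervalIntegral.integral_neg, ← intervalIntegral.integral_sub]
    · refine intervalIntegral.integral_congr_ae ?_
      filter_upwards [hae hr] with s hs hsτ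
      rw [← hs hsτ, ip_apply, real_inner_comm, Function.comp_apply]
      linarith [hdual s (ρ s)]
    · exact (intervalIntegrable_bilin_right b h0τ hcz.continuousOn hτρ).neg
    · exact (intervalIntegrable_bilin_right b h0τ hz''.continuousOn hτρ).const_mul δ
  have iq : IntervalIntegrable (fun s => ⟪q s, J (z' s)⟫) volume 0 τ :=
    intervalIntegrable_bilin_left (ip X) h0τ hτq (J.continuous.comp hcz').continuousOn
  have iε : IntervalIntegrable (fun s => ⟪ε' s, J (z' s)⟫) volume 0 τ :=
    intervalIntegrable_bilin_left (ip X) h0τ hτε (J.continuous.comp hcz').continuousOn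
  have hS1 : ∫ s in (0 : ℝ)..τ, ip X (q s + ε' s) (J (z' s))
      = (∫ s in (0 : ℝ)..τ, ⟪q s, J (z' s)⟫) + ∫ s in (0 : ℝ)..τ, ⟪ε' s, J (z' s)⟫ := by
    rw [← intervalIntegral.integral_add iq iε]
    simp only [ip_apply, inner_add_left]
  have hE : ∫ s in (0 : ℝ)..τ, e'' s (z s)
      = (∫ s in (0 : ℝ)..τ, ⟪R s, J (z s)⟫) - ∫ s in (0 : ℝ)..τ, b (z s) (ρ s) := by
    rw [← intervalIntegral.integral_sub]
    · refine intervalIntegral.integral_congr_ae ?_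
      filter_upwards [hae heq] with s hs' hsτ
      rw [← hs' hsτ (z s), hs (ρ s)]
      ring
    · exact intervalIntegrable_bilin_left (ip X) h0τ hτR (J.continuous.comp hcz).continuousOn
    · exact intervalIntegrable_bilin_right b h0τ hcz.continuousOn hτρ
  simp only [ContinuousLinearMap.id_apply] at hP
  rw [hP2, hE] at hP
  rw [hS1, hS2] at hS
  simp only [hz0, hz1, map_zero, map_neg, intervalIntegral.integral_same, add_zero, ip_apply,
    ContinuousLinearMap.comp_apply, innerSL_apply_apply] at hP hS
  linarith

-- The quadratic polynomial x ↦ b(z + xv, z + xv) is nonnegative, so its discriminant is not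
-- positive.
omit [CompleteSpace H] in
lemma abs_form_le (b : H →L[ℝ] H →L[ℝ] ℝ) (hs : ∀ z v, b z v = b v z) (hb0 : ∀ v, 0 ≤ b v v)
    (z v : H) : |b z v| ≤ √(b z z) * √(b v v) := by
  rw [← Real.sqrt_mul (hb0 z)]
  refine Real.abs_le_sqrt ?_
  have h := discrim_le_zero (a := b v v) (b := 2 * b z v) (c := b z z) fun x => by
    have h1 := hb0 (z + x • v)
    simp only [map_add, map_smul, add_apply, smul_apply, smul_eq_mul] at h1
    rw [hs v z] at h1
    linarith
  unfold discrim at h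
  nlinarith

/-- Stability of the wave equation in `L∞(0,T;X)`, with the constant one. -/
theorem dual_stability (J : H →L[ℝ] X) (b : H →L[ℝ] H →L[ℝ] ℝ) (hs : ∀ z v, b z v = b v z)
    (hb0 : ∀ v, 0 ≤ b v v) {c C : ℝ} (hc : 0 < c)
    (hb : ∀ v, c * ‖v‖ ^ 2 ≤ c * ‖J v‖ ^ 2 + b v v) (hC0 : 0 ≤ C)
    (hC : ∀ v, ‖J v‖ ^ 2 ≤ C * b v v)
    {T : ℝ} {ρ : ℝ → H} (hρ : IntervalIntegrable ρ volume 0 T)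
    {q ε' R : ℝ → X} {e'' : ℝ → StrongDual ℝ H} (hqi : IntervalIntegrable q volume 0 T)
    (hεi : IntervalIntegrable ε' volume 0 T) (hRi : IntervalIntegrable R volume 0 T)
    (hei : IntervalIntegrable e'' volume 0 T) {r₀ e₁ : X}
    (hr : ∀ᵐ s ∂(volume.restrict (Ioc 0 T)), J (ρ s) = r₀ + ∫ r in (0 : ℝ)..s, (q r + ε' r))
    (hq : ∀ᵐ s ∂(volume.restrict (Ioc 0 T)),
      (innerSL ℝ (q s)).comp J = (innerSL ℝ e₁).comp J + ∫ r in (0 : ℝ)..s, e'' r)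
    (heq : ∀ᵐ s ∂(volume.restrict (Ioc 0 T)), ∀ v, e'' s v + b (ρ s) v = ⟪R s, J v⟫)
    {Q : ℝ} (hQ : ∀ κ ζ ζ', 0 ≤ κ → IsTest T κ ζ ζ' → ∫ s in (0 : ℝ)..T, ⟪R s, ζ s⟫ ≤ κ * Q) :
    ∀ᵐ τ ∂(volume.restrict (Ioc 0 T)),
      ‖J (ρ τ)‖ ≤ ‖r₀‖ + (∫ s in (0 : ℝ)..T, ‖ε' s‖) + min T √C * ‖e₁‖ + Q := by
  -- Fix a time at which J ρ(τ) agrees with its primitive. Since ρ(τ) lies in H, it may serve as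
  -- terminal velocity of the dual problem.
  filter_upwards [hr, ae_restrict_mem measurableSet_Ioc] with τ hrτ hτ
  have h0τ : (0 : ℝ) ≤ τ := hτ.1.le
  have hsub : uIcc 0 τ ⊆ uIcc 0 T := by
    rw [uIcc_of_le h0τ, uIcc_of_le (h0τ.trans hτ.2)]
    exact Icc_subset_Icc_right hτ.2
  have hsub' : uIcc τ T ⊆ uIcc 0 T := by
    rw [uIcc_of_le hτ.2, uIcc_of_le (h0τ.trans hτ.2)]
    exact Icc_subset_Icc_left h0τ
  set φ := ρ τ with hφ
  set S := ‖r₀‖ + (∫ s in (0 : ℝ)..T, ‖ε' s‖) + min T √C * ‖e₁‖ + Q with hS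
  set D := √(b φ φ) * (√‖b‖ * ∫ s in (0 : ℝ)..τ, ‖ρ s‖) with hD
  have main : ∀ δ : ℝ, 0 < δ → δ * c ≤ 1 →
      ‖J φ‖ ^ 2 ≤ √(‖J φ‖ ^ 2 + δ * b φ φ) * S + √δ * D := by
    intro δ hδ hδc
    obtain ⟨z, z', z'', hz, hz', hz'', hz0, hz1, hdual, hB1, hB2, hB3⟩ :=
      exists_dual J b hs hb0 hc hb hδ hδc τ φ
    have hcz : Continuous z := continuous_iff_continuousAt.2 fun s => (hz s).continuousAt
    have hcz' : Continuous z' := continuous_iff_continuousAt.2 fun s => (hz' s).continuousAt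
    have hrep := dual_representation J b hs hρ hqi hεi hRi hei hr hq heq hτ hz hz' hz'' hz0 hz1 hdual
    rw [← hrτ, real_inner_self_eq_norm_sq] at hrep
    set κ := √(‖J φ‖ ^ 2 + δ * b φ φ) with hκ
    have hκ0 : 0 ≤ κ := Real.sqrt_nonneg _
    have hJz' : ∀ s, ‖J (z' s)‖ ≤ κ := fun s => Real.le_sqrt_of_sq_le (hB1 s)
    -- After continuation by zero the residual is tested on all of [0, T], with τ no longer visible;
    -- hence `hQ` is needed only for the full time interval.
    have htest := isTest_dual J hτ hz hcz' hz0 hκ0 hJz'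
    -- the residual
    have t5 : ∫ s in (0 : ℝ)..τ, ⟪R s, J (z s)⟫ ≤ κ * Q := by
      refine le_trans (le_of_eq ?_) (hQ κ _ _ hκ0 htest)
      have iR : ∀ a b, uIcc a b ⊆ uIcc 0 T → a ≤ b →
          IntervalIntegrable (fun s => ⟪R s, J (z (min s τ))⟫) volume a b := fun a b h hab =>
        intervalIntegrable_bilin_left (ip X) hab (hRi.mono_set h)
          (J.continuous.comp (hcz.comp (continuous_id.min continuous_const))).continuousOn
      rw [← intervalIntegral.integral_add_adjacent_intervals (iR 0 τ hsub h0τ) (iR τ T hsub' hτ.2)]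
      have e1 : ∫ s in (0 : ℝ)..τ, ⟪R s, J (z (min s τ))⟫ = ∫ s in (0 : ℝ)..τ, ⟪R s, J (z s)⟫ := by
        refine intervalIntegral.integral_congr fun s hs => ?_
        rw [uIcc_of_le h0τ] at hs
        simp only [min_eq_left hs.2]
      have e2 : ∫ s in τ..T, ⟪R s, J (z (min s τ))⟫ = 0 := by
        rw [← intervalIntegral.integral_zero (a := τ) (b := T) (μ := volume) (E := ℝ)]
        refine intervalIntegral.integral_congr fun s hs => ?_
        rw [uIcc_of_le hτ.2] at hs
        simp only [min_eq_right hs.1, hz0, map_zero, inner_zero_right]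
      rw [e1, e2, add_zero]
    -- the initial values
    have t2 : -⟪r₀, J (z' 0)⟫ ≤ κ * ‖r₀‖ := by
      have h1 := abs_le.1 (abs_real_inner_le_norm r₀ (J (z' 0)))
      nlinarith [mul_le_mul_of_nonneg_left (hJz' 0) (norm_nonneg r₀)]
    -- The bound κT comes from integrating z' back from the final value 0, the bound κ√C from the
    -- energy b(z, z) and the Poincaré inequality.
    have hJz0 : ‖J (z 0)‖ ≤ κ * min T √C := by
      rw [mul_min_of_nonneg _ _ hκ0]
      refine le_min ?_ ?_
      · have h1 := htest.eq_integral T ⟨h0τ.trans hτ.2, le_rfl⟩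
        rw [htest.final] at h1
        simp only [min_eq_left h0τ] at h1
        rw [eq_neg_of_add_eq_zero_left h1.symm, norm_neg]
        have h2 := intervalIntegral.norm_integral_le_of_norm_le_const (a := 0) (b := T)
          (f := {s | s ≤ τ}.indicator fun s => J (z' s)) fun s _ => htest.norm_le s
        rwa [sub_zero, abs_of_nonneg (h0τ.trans hτ.2)] at h2
      · rw [hκ, ← Real.sqrt_mul (by have := hb0 φ; positivity)]
        refine Real.le_sqrt_of_sq_le ((hC _).trans ?_)
        rw [mul_comm]
        exact mul_le_mul_of_nonneg_right (hB2 0) hC0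
    have t1 : ⟪e₁, J (z 0)⟫ ≤ κ * (min T √C * ‖e₁‖) := by
      have h1 := real_inner_le_norm e₁ (J (z 0))
      nlinarith [mul_le_mul_of_nonneg_left hJz0 (norm_nonneg e₁)]
    -- the forcing of the first derivative
    have t3 : -(∫ s in (0 : ℝ)..τ, ⟪ε' s, J (z' s)⟫) ≤ κ * ∫ s in (0 : ℝ)..T, ‖ε' s‖ := by
      have h1 : ‖∫ s in (0 : ℝ)..τ, ⟪ε' s, J (z' s)⟫‖ ≤ ∫ s in (0 : ℝ)..τ, ‖ε' s‖ * κ := by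
        refine intervalIntegral.norm_integral_le_of_norm_le h0τ (ae_of_all _ fun s _ => ?_)
          ((hεi.mono_set hsub).norm.mul_const κ)
        exact (norm_inner_le_norm _ _).trans (mul_le_mul_of_nonneg_left (hJz' s) (norm_nonneg _))
      have h2 : ∫ s in (0 : ℝ)..τ, ‖ε' s‖ ≤ ∫ s in (0 : ℝ)..T, ‖ε' s‖ :=
        intervalIntegral.integral_mono_interval le_rfl h0τ hτ.2
          (ae_of_all _ fun s => norm_nonneg _) hεi.norm
      rw [intervalIntegral.integral_mul_const, Real.norm_eq_abs] at h1
      nlinarith [(abs_le.1 h1).1]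
    -- the regularisation
    have t4 : ∫ s in (0 : ℝ)..τ, δ * b (z'' s) (ρ s) ≤ √δ * D := by
      have h1 : ‖∫ s in (0 : ℝ)..τ, δ * b (z'' s) (ρ s)‖
          ≤ ∫ s in (0 : ℝ)..τ, (√δ * √(b φ φ) * √‖b‖) * ‖ρ s‖ := by
        refine intervalIntegral.norm_integral_le_of_norm_le h0τ (ae_of_all _ fun s _ => ?_)
          ((hρ.mono_set hsub).norm.const_mul _)
        rw [norm_mul, Real.norm_eq_abs, Real.norm_eq_abs, abs_of_pos hδ]
        have h2 := abs_form_le b hs hb0 (z'' s) (ρ s)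
        have h3 : √(b (ρ s) (ρ s)) ≤ √‖b‖ * ‖ρ s‖ := by
          rw [← Real.sqrt_sq (norm_nonneg (ρ s)), ← Real.sqrt_mul (norm_nonneg b)]
          refine Real.sqrt_le_sqrt ?_
          rw [sq, ← mul_assoc]
          exact (le_abs_self _).trans (b.le_opNorm₂ _ _)
        -- The energy bound on b(z'', z'') is of order 1/δ, which uses up one factor √δ and leaves
        -- the other.
        have h4 : √δ * √(b (z'' s) (z'' s)) ≤ √(b φ φ) := by
          rw [← Real.sqrt_mul hδ.le]
          exact Real.sqrt_le_sqrt (hB3 s)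
        calc δ * |b (z'' s) (ρ s)|
            ≤ δ * (√(b (z'' s) (z'' s)) * √(b (ρ s) (ρ s))) := mul_le_mul_of_nonneg_left h2 hδ.le
          _ = √δ * ((√δ * √(b (z'' s) (z'' s))) * √(b (ρ s) (ρ s))) := by
              nth_rw 1 [← Real.mul_self_sqrt hδ.le]
              ring
          _ ≤ √δ * (√(b φ φ) * (√‖b‖ * ‖ρ s‖)) := by gcongr
          _ = √δ * √(b φ φ) * √‖b‖ * ‖ρ s‖ := by ring
      refine (le_abs_self _).trans (h1.trans (le_of_eq ?_))
      rw [intervalIntegral.integral_const_mul, hD]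
      ring
    rw [hS]
    linarith
  -- the limit `δ → 0`
  have hlim : Filter.Tendsto (fun δ : ℝ => √(‖J φ‖ ^ 2 + δ * b φ φ) * S + √δ * D)
      (nhdsWithin 0 (Ioi 0)) (nhds (√(‖J φ‖ ^ 2 + 0 * b φ φ) * S + √0 * D)) := by
    refine Filter.Tendsto.mono_left ?_ nhdsWithin_le_nhds
    exact Continuous.tendsto (by fun_prop) 0
  have hle : ‖J φ‖ ^ 2 ≤ √(‖J φ‖ ^ 2 + 0 * b φ φ) * S + √0 * D := by
    refine ge_of_tendsto hlim ?_
    filter_upwards [Ioc_mem_nhdsGT (show (0 : ℝ) < 1 / c by positivity)] with δ hδ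
    exact main δ hδ.1 ((le_div_iff₀ hc).1 hδ.2)
  rw [zero_mul, add_zero, Real.sqrt_sq (norm_nonneg _), Real.sqrt_zero, zero_mul, add_zero] at hle
  -- If Jφ = 0 nothing can be cancelled, and the right side must be seen to be nonnegative; for `Q`
  -- this follows by testing with zero.
  rcases (norm_nonneg (J φ)).eq_or_lt with h | h
  · rw [← h, hS]
    have hQ0 : 0 ≤ Q := by
      have := hQ 1 (fun _ => 0) (fun _ => 0) zero_le_one ⟨by simp, by simp, by simp, rfl⟩
      simpa using this
    have h1 : 0 ≤ ∫ s in (0 : ℝ)..T, ‖ε' s‖ :=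
      intervalIntegral.integral_nonneg (h0τ.trans hτ.2) fun s _ => norm_nonneg _
    have h2 : 0 ≤ min T √C := le_min (h0τ.trans hτ.2) (Real.sqrt_nonneg _)
    positivity
  · rw [sq] at hle
    exact le_of_mul_le_mul_left hle h

end Stability

/-! ### The cubic time reconstruction on one interval -/

section Reconstruction

variable {X : Type*} [NormedAddCommGroup X] [NormedSpace ℝ X]

/-- The time reconstruction on the `n`-th interval. -/
def localRec (t : ℕ → ℝ) (x : ℕ → X) (dx₀ : X) (n : ℕ) (s : ℝ) : X :=
  ((s - t (n - 1)) / step t n) • x n + ((t n - s) / step t n) • x (n - 1)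
    - ((s - t (n - 1)) * (t n - s) ^ 2 / step t n) • bdiff2 t x dx₀ n

/-- The time derivative of the reconstruction on the `n`-th interval. -/
def localRec' (t : ℕ → ℝ) (x : ℕ → X) (dx₀ : X) (n : ℕ) (s : ℝ) : X :=
  bdiff t x dx₀ n
    - (((t n - s) ^ 2 - 2 * ((s - t (n - 1)) * (t n - s))) / step t n) • bdiff2 t x dx₀ n

/-- The second time derivative of the reconstruction on the `n`-th interval. -/
def localRec'' (t : ℕ → ℝ) (x : ℕ → X) (dx₀ : X) (n : ℕ) (s : ℝ) : X :=
  bdiff2 t x dx₀ n + mu t n s • bdiff2 t x dx₀ n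

/-- The function `𝒢` on the `n`-th interval. -/
def localG (t : ℕ → ℝ) (g : ℕ → X) (dg₀ : X) (n : ℕ) (s : ℝ) : X :=
  ((t n - s) ^ 2 / 2) • bdiff t g dg₀ n
    - ((t n - s) ^ 4 / (4 * step t n) - (t n - s) ^ 3 / 3) • bdiff2 t g dg₀ n
    - gam t g dg₀ n

variable (t : ℕ → ℝ) (x : ℕ → X) (dx₀ : X)

lemma timeRec_of_pos (N : ℕ) {s : ℝ} (hs : 0 < s) :
    timeRec t N x dx₀ s = pw t N (localRec t x dx₀) s := by
  rw [timeRec, if_neg (not_le.2 hs)]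
  rfl

lemma evolG_eq_pw (N : ℕ) : evolG t N x dx₀ = pw t N (localG t x dx₀) := rfl

variable {n : ℕ}

lemma step_smul_bdiff (h1 : 1 ≤ n) (hk : step t n ≠ 0) :
    step t n • bdiff t x dx₀ n = x n - x (n - 1) := by
  rw [bdiff, if_neg (by omega), smul_inv_smul₀ hk]

lemma step_smul_bdiff2 (hk : step t n ≠ 0) :
    step t n • bdiff2 t x dx₀ n = bdiff t x dx₀ n - bdiff t x dx₀ (n - 1) := by
  rw [bdiff2, smul_inv_smul₀ hk]

lemma continuous_localRec : Continuous (localRec t x dx₀ n) := by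
  unfold localRec; fun_prop

lemma continuous_localRec' : Continuous (localRec' t x dx₀ n) := by
  unfold localRec'; fun_prop

lemma continuous_localRec'' : Continuous (localRec'' t x dx₀ n) := by
  unfold localRec'' mu; fun_prop

lemma continuous_localG : Continuous (localG t x dx₀ n) := by
  unfold localG; fun_prop

lemma hasDerivAt_localRec (h1 : 1 ≤ n) (s : ℝ) :
    HasDerivAt (localRec t x dx₀ n) (localRec' t x dx₀ n s) s := by
  have a1 : HasDerivAt (fun s => (s - t (n - 1)) / step t n) (1 / step t n) s :=
    ((hasDerivAt_id s).sub_const _).div_const _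
  have a2 : HasDerivAt (fun s => (t n - s) / step t n) (-1 / step t n) s :=
    ((hasDerivAt_id s).const_sub _).div_const _
  have a3 : HasDerivAt (fun s => (s - t (n - 1)) * (t n - s) ^ 2 / step t n)
      (((t n - s) ^ 2 - 2 * ((s - t (n - 1)) * (t n - s))) / step t n) s := by
    refine ((((hasDerivAt_id s).sub_const _).mul
      (((hasDerivAt_id s).const_sub _).pow 2)).div_const _).congr_deriv ?_
    simp only [id, Pi.pow_apply]
    push_cast
    ring
  refine (((a1.smul_const (x n)).add (a2.smul_const (x (n - 1)))).sub
    (a3.smul_const _)).congr_deriv ?_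
  rw [localRec', bdiff, if_neg (by omega)]
  module

lemma hasDerivAt_localRec' (hk : step t n ≠ 0) (s : ℝ) :
    HasDerivAt (localRec' t x dx₀ n) (localRec'' t x dx₀ n s) s := by
  have a3 : HasDerivAt
      (fun s => ((t n - s) ^ 2 - 2 * ((s - t (n - 1)) * (t n - s))) / step t n)
      (-(1 + mu t n s)) s := by
    refine (((((hasDerivAt_id s).const_sub (t n)).pow 2).sub
      ((((hasDerivAt_id s).sub_const (t (n - 1))).mul
        ((hasDerivAt_id s).const_sub (t n))).const_mul 2)).div_const _).congr_deriv ?_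
    rw [mu]
    simp only [id]
    field_simp
    rw [step]
    push_cast
    ring
  refine ((hasDerivAt_const s (bdiff t x dx₀ n)).sub (a3.smul_const _)).congr_deriv ?_
  rw [localRec'']
  module

lemma localRec_right (hk : step t n ≠ 0) : localRec t x dx₀ n (t n) = x n := by
  have : (t n - t (n - 1)) / step t n = 1 := div_self hk
  simp [localRec, this]

lemma localRec_left (hk : step t n ≠ 0) : localRec t x dx₀ n (t (n - 1)) = x (n - 1) := by
  have : (t n - t (n - 1)) / step t n = 1 := div_self hk
  simp [localRec, this]

lemma localRec'_right : localRec' t x dx₀ n (t n) = bdiff t x dx₀ n := by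
  simp [localRec']

/-- At the left end the cubic correction has slope k_n ∂²xⁿ, exactly what turns ∂xⁿ into ∂xⁿ⁻¹. This
makes the pieces match in C¹. -/
lemma localRec'_left (hk : step t n ≠ 0) :
    localRec' t x dx₀ n (t (n - 1)) = bdiff t x dx₀ (n - 1) := by
  have h1 := step_smul_bdiff2 t x dx₀ hk
  have h2 : ((t n - t (n - 1)) ^ 2 - 2 * ((t (n - 1) - t (n - 1)) * (t n - t (n - 1)))) / step t n
      = step t n := by
    rw [← step]
    field_simp
    ring
  rw [localRec', h2, h1]
  abel

/-- Identifies 𝒢 as a primitive of g(t) - gⁿ, which is why it measures the evolution error. -/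
lemma hasDerivAt_localG (h1 : 1 ≤ n) (hk : step t n ≠ 0) (s : ℝ) :
    HasDerivAt (localG t x dx₀ n) (localRec t x dx₀ n s - x n) s := by
  have hid := (hasDerivAt_id s).const_sub (t n)
  have a1 : HasDerivAt (fun s => (t n - s) ^ 2 / 2) (-(t n - s)) s := by
    refine ((hid.pow 2).div_const 2).congr_deriv ?_
    simp only [id]
    push_cast
    ring
  -- Writing s - tⁿ⁻¹ = k_n - (tⁿ - s) turns the cubic into (tⁿ - s)² - (tⁿ - s)³/k_n, whose
  -- primitive is the quartic here.
  have a2 : HasDerivAt (fun s => (t n - s) ^ 4 / (4 * step t n) - (t n - s) ^ 3 / 3)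
      ((s - t (n - 1)) * (t n - s) ^ 2 / step t n) s := by
    refine (((hid.pow 4).div_const (4 * step t n)).sub ((hid.pow 3).div_const 3)).congr_deriv ?_
    simp only [id]
    field_simp
    rw [step]
    push_cast
    ring
  refine (((a1.smul_const (bdiff t x dx₀ n)).sub (a2.smul_const (bdiff2 t x dx₀ n))).sub
    (hasDerivAt_const s (gam t x dx₀ n))).congr_deriv ?_
  have e1 : (t n - s) • bdiff t x dx₀ n = ((t n - s) / step t n) • (x n - x (n - 1)) := by
    rw [← step_smul_bdiff t x dx₀ h1 hk, smul_smul, div_mul_cancel₀ _ hk]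
  have e2 : (s - t (n - 1)) / step t n = 1 - (t n - s) / step t n := by
    field_simp
    rw [step]
    ring
  rw [localRec, neg_smul, e1, e2]
  module

lemma localG_right : localG t x dx₀ n (t n) = -gam t x dx₀ n := by
  simp [localG]

/-- The recursion for γ is chosen for this value: together with `localG_right` it makes 𝒢 continuous
across the nodes. -/
lemma localG_left (h1 : 1 ≤ n) (hk : step t n ≠ 0) :
    localG t x dx₀ n (t (n - 1)) = -gam t x dx₀ (n - 1) := by
  obtain ⟨m, rfl⟩ := Nat.exists_eq_add_of_le' h1
  have e1 : t (m + 1) - t (m + 1 - 1) = step t (m + 1) := rfl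
  have e2 : step t (m + 1) ^ 4 / (4 * step t (m + 1)) - step t (m + 1) ^ 3 / 3
      = -(step t (m + 1) ^ 3 / 12) := by
    field_simp
    ring
  rw [localG, e1, e2, gam, Nat.add_sub_cancel]
  module

lemma integral_mu : ∫ s in (t (n - 1))..(t n), mu t n s = 0 := by
  unfold mu
  rw [intervalIntegral.integral_const_mul, intervalIntegral.integral_sub (by simp) (by simp)]
  simp
  right
  ring

end Reconstruction

/-! ### Bounds for pairings with Lipschitz test functions -/

section TestBounds

variable {X : Type*} [NormedAddCommGroup X] [InnerProductSpace ℝ X] [CompleteSpace X]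
  {T κ : ℝ} {ζ ζ' : ℝ → X}

omit [CompleteSpace X] in
lemma IsTest.intervalIntegrable (h : IsTest T κ ζ ζ') {a b : ℝ} (ha : a ∈ Icc 0 T)
    (hb : b ∈ Icc 0 T) : IntervalIntegrable ζ' volume a b := by
  refine h.integrable.mono_set ?_
  rw [uIcc_of_le (ha.1.trans ha.2)]
  exact uIcc_subset_Icc ha hb

omit [CompleteSpace X] in
lemma IsTest.sub_eq (h : IsTest T κ ζ ζ') {a b : ℝ} (ha : a ∈ Icc 0 T) (hb : b ∈ Icc 0 T) :
    ζ b = ζ a + ∫ r in a..b, ζ' r := by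
  have h0 : (0 : ℝ) ∈ Icc 0 T := ⟨le_rfl, ha.1.trans ha.2⟩
  rw [h.eq_integral b hb, h.eq_integral a ha, add_assoc,
    intervalIntegral.integral_add_adjacent_intervals (h.intervalIntegrable h0 ha)
      (h.intervalIntegrable ha hb)]

omit [CompleteSpace X] in
lemma IsTest.lipschitz (h : IsTest T κ ζ ζ') {a b : ℝ} (ha : a ∈ Icc 0 T) (hb : b ∈ Icc 0 T) :
    ‖ζ b - ζ a‖ ≤ κ * |b - a| := by
  rw [h.sub_eq ha hb, add_sub_cancel_left]
  exact intervalIntegral.norm_integral_le_of_norm_le_const fun s _ => h.norm_le s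

-- Integration back from ζ(T) = 0. The distance to the final time becomes the weight tᴺ - tʲ of the
-- mesh change terms.
omit [CompleteSpace X] in
lemma IsTest.norm_apply_le (h : IsTest T κ ζ ζ') {a : ℝ} (ha : a ∈ Icc 0 T) :
    ‖ζ a‖ ≤ κ * (T - a) := by
  have := h.lipschitz (b := a) (a := T) ⟨ha.1.trans ha.2, le_rfl⟩ ha
  rwa [h.final, sub_zero, abs_sub_comm, abs_of_nonneg (sub_nonneg.2 ha.2)] at this

omit [CompleteSpace X] in
lemma IsTest.continuousOn (h : IsTest T κ ζ ζ') (hT : 0 ≤ T) : ContinuousOn ζ (Icc 0 T) :=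
  continuousOn_of_eq_primitive hT h.integrable h.eq_integral

/-- Only the L¹ norm of the primitive `F` is paid, because the derivative is moved to ζ, where it is
bounded by κ. -/
lemma IsTest.integral_deriv_le (h : IsTest T κ ζ ζ') {a b : ℝ} (ha : 0 ≤ a) (hab : a ≤ b)
    (hb : b ≤ T) {F F' : ℝ → X} (hF : ∀ s, HasDerivAt F (F' s) s) (hF' : Continuous F') :
    ∫ s in a..b, ⟪F' s, ζ s⟫
      ≤ ⟪F b, ζ b⟫ - ⟪F a, ζ a⟫ + κ * ∫ s in a..b, ‖F s‖ := by
  have hcF : Continuous F := continuous_iff_continuousAt.2 fun s => (hF s).continuousAt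
  have haT : a ∈ Icc 0 T := ⟨ha, hab.trans hb⟩
  have hbT : b ∈ Icc 0 T := ⟨ha.trans hab, hb⟩
  have hp := integral_bilin_by_parts (ip X) hab (hF'.intervalIntegrable a b)
    (h.intervalIntegrable haT hbT) (x := F) (y := ζ)
    (fun s _ => by
      rw [intervalIntegral.integral_eq_sub_of_hasDerivAt (fun r _ => hF r)
        (hF'.intervalIntegrable _ _)]
      abel)
    (fun s hs => h.sub_eq haT ⟨ha.trans hs.1, hs.2.trans hb⟩)
  simp only [ip_apply] at hp
  rw [hp]
  have hn : ‖∫ s in a..b, ⟪F s, ζ' s⟫‖ ≤ ∫ s in a..b, κ * ‖F s‖ := by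
    refine intervalIntegral.norm_integral_le_of_norm_le hab (ae_of_all _ fun s _ => ?_)
      ((hcF.norm.const_mul κ).intervalIntegrable _ _)
    rw [mul_comm κ]
    exact (norm_inner_le_norm _ _).trans (mul_le_mul_of_nonneg_left (h.norm_le s) (norm_nonneg _))
  rw [intervalIntegral.integral_const_mul, Real.norm_eq_abs] at hn
  linarith [(abs_le.1 hn).1]

omit [NormedAddCommGroup X] [InnerProductSpace ℝ X] [CompleteSpace X] in
lemma integral_mul_le_sqrt {α : Type*} [MeasurableSpace α] {μ : Measure α} {u v : α → ℝ}
    (hu : Integrable (fun x => u x ^ 2) μ) (hv : Integrable (fun x => v x ^ 2) μ)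
    (huv : Integrable (fun x => u x * v x) μ) :
    ∫ x, u x * v x ∂μ ≤ √((∫ x, u x ^ 2 ∂μ) * ∫ x, v x ^ 2 ∂μ) := by
  refine Real.le_sqrt_of_sq_le ?_
  have h := discrim_le_zero (a := ∫ x, v x ^ 2 ∂μ) (b := 2 * ∫ x, u x * v x ∂μ)
    (c := ∫ x, u x ^ 2 ∂μ) fun y => by
    have h1 : 0 ≤ ∫ x, (u x + y * v x) ^ 2 ∂μ := integral_nonneg fun x => sq_nonneg _
    have h2 : ∫ x, (u x + y * v x) ^ 2 ∂μ
        = ∫ x, (y * y * v x ^ 2 + 2 * y * (u x * v x) + u x ^ 2) ∂μ := by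
      refine integral_congr_ae (ae_of_all _ fun x => ?_)
      simp only
      ring
    have h3 : Integrable (fun x => y * y * v x ^ 2 + 2 * y * (u x * v x)) μ :=
      (hv.const_mul _).add (huv.const_mul _)
    rw [h2, integral_add h3 hu, integral_add (hv.const_mul _) (huv.const_mul _), integral_const_mul, integral_const_mul] at h1
    linarith
  unfold discrim at h
  nlinarith

/-- Testing a function with mean value zero. -/
lemma IsTest.integral_mean_zero_le (h : IsTest T κ ζ ζ') (hκ : 0 ≤ κ) {a b : ℝ} (ha : 0 ≤ a)
    (hab : a ≤ b) (hb : b ≤ T) {p : ℝ → X} (hp : MemLp p 2 (volume.restrict (Ioc a b)))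
    (hp0 : ∫ s in a..b, p s = 0) :
    ∫ s in a..b, ⟪p s, ζ s⟫ ≤ κ * (1 / Real.pi * √(∫ s in a..b, (b - a) ^ 3 * ‖p s‖ ^ 2)) := by
  -- As p has mean value zero, ζ(m) may be subtracted for any m; the midpoint minimises ∫|s - m|²,
  -- with value (b - a)³/12.
  set m := (a + b) / 2 with hm
  have hmab : m ∈ Icc a b := ⟨by rw [hm]; linarith, by rw [hm]; linarith⟩
  have hmT : m ∈ Icc 0 T := ⟨ha.trans hmab.1, hmab.2.trans hb⟩
  have hsub : Icc a b ⊆ Icc 0 T := Icc_subset_Icc ha hb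
  have hT : 0 ≤ T := hmT.1.trans hmT.2
  have hpI : IntegrableOn p (Ioc a b) := hp.integrable one_le_two
  have hpi : IntervalIntegrable p volume a b := (intervalIntegrable_iff_integrableOn_Ioc_of_le hab).2 hpI
  have hζ := (h.continuousOn hT).mono hsub
  have e1 : ∫ s in a..b, ⟪p s, ζ s⟫ = ∫ s in a..b, ⟪p s, ζ s - ζ m⟫ := by
    have : ∫ s in a..b, ⟪p s, ζ m⟫ = 0 := by
      have h1 := ((ip X).flip (ζ m)).intervalIntegral_comp_comm hpi
      rw [hp0, map_zero] at h1
      exact h1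
    have j1 : IntervalIntegrable (fun s => ⟪p s, ζ s⟫) volume a b :=
      intervalIntegrable_bilin_left (ip X) hab hpi hζ
    have j2 : IntervalIntegrable (fun s => ⟪p s, ζ m⟫) volume a b :=
      intervalIntegrable_bilin_left (ip X) hab hpi continuousOn_const
    rw [← sub_zero (∫ s in a..b, ⟪p s, ζ s⟫), ← this, ← intervalIntegral.integral_sub j1 j2]
    simp only [inner_sub_right]
  have hcm : ContinuousOn (fun s : ℝ => |s - m|) (Icc a b) := by fun_prop
  have i3 : IntervalIntegrable (fun s => ‖p s‖ * |s - m|) volume a b :=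
    intervalIntegrable_bilin_left (ContinuousLinearMap.mul ℝ ℝ) hab hpi.norm hcm
  have e2 : ∫ s in a..b, ⟪p s, ζ s - ζ m⟫ ≤ κ * ∫ s in a..b, ‖p s‖ * |s - m| := by
    rw [← intervalIntegral.integral_const_mul]
    refine intervalIntegral.integral_mono_on hab
      (intervalIntegrable_bilin_left (ip X) hab hpi (hζ.sub continuousOn_const))
      (i3.const_mul κ) fun s hs => ?_
    refine (real_inner_le_norm _ _).trans ?_
    have := mul_le_mul_of_nonneg_left (h.lipschitz hmT (hsub hs)) (norm_nonneg (p s))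
    linarith
  have i1 : Integrable (fun s => ‖p s‖ ^ 2) (volume.restrict (Ioc a b)) :=
    (memLp_two_iff_integrable_sq_norm hp.1).1 hp
  have i2 : Integrable (fun s => |s - m| ^ 2) (volume.restrict (Ioc a b)) :=
    Continuous.integrableOn_Ioc (by fun_prop)
  have e3 := integral_mul_le_sqrt i1 i2 ((intervalIntegrable_iff_integrableOn_Ioc_of_le hab).1 i3)
  rw [← intervalIntegral.integral_of_le hab, ← intervalIntegral.integral_of_le hab,
    ← intervalIntegral.integral_of_le hab] at e3
  have e4 : ∫ s in a..b, |s - m| ^ 2 = (b - a) ^ 3 / 12 := by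
    simp only [sq_abs]
    rw [intervalIntegral.integral_comp_sub_right (fun s => s ^ 2) m, integral_pow, hm]
    push_cast
    ring
  have e5 : √((∫ s in a..b, ‖p s‖ ^ 2) * ((b - a) ^ 3 / 12))
      ≤ 1 / Real.pi * √(∫ s in a..b, (b - a) ^ 3 * ‖p s‖ ^ 2) := by
    have hπ := Real.pi_pos
    -- Cauchy–Schwarz yields the constant 1/√12, which is smaller than the 1/π of the indicators.
    have h12 : Real.pi ^ 2 ≤ 12 := by nlinarith [Real.pi_lt_d2]
    have h0 : 0 ≤ ∫ s in a..b, (b - a) ^ 3 * ‖p s‖ ^ 2 :=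
      intervalIntegral.integral_nonneg hab fun s _ => by
        have := sub_nonneg.2 hab
        positivity
    have h1 : (1 / Real.pi) = √((1 / Real.pi) ^ 2) := (Real.sqrt_sq (by positivity)).symm
    rw [h1, ← Real.sqrt_mul (by positivity)]
    refine Real.sqrt_le_sqrt ?_
    rw [intervalIntegral.integral_const_mul] at h0 ⊢
    have h2 : 1 / 12 ≤ (1 / Real.pi) ^ 2 := by
      rw [div_pow, one_pow]
      exact one_div_le_one_div_of_le (by positivity) h12
    nlinarith [mul_le_mul_of_nonneg_right h2 h0]
  rw [e4] at e3
  rw [e1]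
  exact e2.trans (mul_le_mul_of_nonneg_left (e3.trans e5) hκ)

end TestBounds

/-! ### The residual and the four indicators -/

section Residual

variable {X : Type*} [NormedAddCommGroup X] [InnerProductSpace ℝ X]

/-- Summation by parts for projections that change from step to step. -/
lemma sum_change_eq (P : ℕ → X →L[ℝ] X) (D Z : ℕ → X) {N : ℕ} (hN : 1 ≤ N) :
    ∑ j ∈ Finset.Icc 1 N,
        (⟪D j - P j (D j), Z j⟫ - ⟪D (j - 1) - P j (D (j - 1)), Z (j - 1)⟫)
      = ⟪D N - P N (D N), Z N⟫ - ⟪D 0 - P 1 (D 0), Z 0⟫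
        + ∑ j ∈ Finset.Icc 1 (N - 1), ⟪P (j + 1) (D j) - P j (D j), Z j⟫ := by
  induction N, hN using Nat.le_induction with
  | base => simp
  | succ n hn ih =>
    rw [Finset.sum_Icc_succ_top (by omega), ih, Nat.add_sub_cancel]
    obtain ⟨m, rfl⟩ := Nat.exists_eq_add_of_le' hn
    rw [Nat.add_sub_cancel, Finset.sum_Icc_succ_top (by omega)]
    simp only [inner_sub_left]
    ring

/-- After summation by parts only jumps of the projections and the term at the initial node remain:
the bound on `Z` forces it to vanish at the last node. -/
lemma sum_change_le {P : ℕ → X →L[ℝ] X} {D Z : ℕ → X} {N : ℕ} (hN : 1 ≤ N) {κ : ℝ} {t : ℕ → ℝ}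
    (hZ : ∀ j ≤ N, ‖Z j‖ ≤ κ * (t N - t j)) :
    ∑ j ∈ Finset.Icc 1 N,
        (⟪D j - P j (D j), Z j⟫ - ⟪D (j - 1) - P j (D (j - 1)), Z (j - 1)⟫)
      ≤ κ * (∑ j ∈ Finset.Icc 1 (N - 1), (t N - t j) * ‖P (j + 1) (D j) - P j (D j)‖
        + (t N - t 0) * ‖D 0 - P 1 (D 0)‖) := by
  have hZN : Z N = 0 := by simpa using hZ N le_rfl
  have hle : ∀ (v : X) (j : ℕ), j ≤ N → |⟪v, Z j⟫| ≤ κ * ((t N - t j) * ‖v‖) := fun v j hj => by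
    refine (abs_real_inner_le_norm _ _).trans ?_
    have := mul_le_mul_of_nonneg_left (hZ j hj) (norm_nonneg v)
    linarith
  rw [sum_change_eq P D Z hN, hZN, inner_zero_right, mul_add, Finset.mul_sum]
  have h1 : ∑ j ∈ Finset.Icc 1 (N - 1), ⟪P (j + 1) (D j) - P j (D j), Z j⟫
      ≤ ∑ j ∈ Finset.Icc 1 (N - 1), κ * ((t N - t j) * ‖P (j + 1) (D j) - P j (D j)‖) := by
    refine Finset.sum_le_sum fun j hj => (le_abs_self _).trans (hle _ j ?_)
    have := Finset.mem_Icc.1 hj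
    omega
  have h2 := (abs_le.1 (hle (D 0 - P 1 (D 0)) 0 (Nat.zero_le N))).1
  linarith

variable [CompleteSpace X] {T κ : ℝ} {ζ ζ' : ℝ → X} {t : ℕ → ℝ} {f : ℝ → X}

lemma integral_fbar_sub {n : ℕ} (h1 : 1 ≤ n) (hk : step t n ≠ 0)
    (hf : IntervalIntegrable f volume (t (n - 1)) (t n)) :
    ∫ s in (t (n - 1))..(t n), (fbar t f n - f s) = 0 := by
  rw [intervalIntegral.integral_sub intervalIntegrable_const hf, intervalIntegral.integral_const,
    ← step, fbar, if_neg (by omega), smul_inv_smul₀ hk, sub_self]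

/-- Testing the residual on one interval. -/
lemma residual_interval_le (h : IsTest T κ ζ ζ') (hκ : 0 ≤ κ) {n : ℕ} (h1 : 1 ≤ n)
    (ha : 0 ≤ t (n - 1)) (hk : 0 < step t n) (hb : t n ≤ T)
    (hf : MemLp f 2 (volume.restrict (Ioc (t (n - 1)) (t n)))) {P : X →L[ℝ] X}
    (hP : ∀ v, ‖P v‖ ≤ ‖v‖) (y g : ℕ → X) (dy₀ dg₀ : X)
    (hg : g n = -P (bdiff2 t y dy₀ n) + fbar t f n) :
    ∫ s in (t (n - 1))..(t n), ⟪localRec'' t y dy₀ n s + localRec t g dg₀ n s - f s, ζ s⟫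
      ≤ (⟪bdiff t y dy₀ n - P (bdiff t y dy₀ n), ζ (t n)⟫
          - ⟪bdiff t y dy₀ (n - 1) - P (bdiff t y dy₀ (n - 1)), ζ (t (n - 1))⟫)
        + (⟪gam t g dg₀ (n - 1), ζ (t (n - 1))⟫ - ⟪gam t g dg₀ n, ζ (t n)⟫)
        + κ * ((∫ s in (t (n - 1))..(t n), ‖localRec' t y dy₀ n s - P (localRec' t y dy₀ n s)‖)
          + (∫ s in (t (n - 1))..(t n), ‖localG t g dg₀ n s‖)
          + 1 / Real.pi * √(∫ s in (t (n - 1))..(t n), step t n ^ 3 * ‖fbar t f n - f s‖ ^ 2)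
          + 1 / Real.pi
            * √(∫ s in (t (n - 1))..(t n), step t n ^ 3 * ‖mu t n s • bdiff2 t y dy₀ n‖ ^ 2)) := by
  have hab : t (n - 1) ≤ t n := (sub_pos.1 hk).le
  have hk0 := hk.ne'
  set D := bdiff2 t y dy₀ n with hD
  have hζ : ContinuousOn ζ (Icc (t (n - 1)) (t n)) :=
    (h.continuousOn (ha.trans (hab.trans hb))).mono (Icc_subset_Icc ha hb)
  have hcmu : Continuous fun s => mu t n s := by unfold mu; fun_prop
  have hfi : IntervalIntegrable f volume (t (n - 1)) (t n) :=
    (intervalIntegrable_iff_integrableOn_Ioc_of_le hab).2 (hf.integrable one_le_two)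
  -- the mesh change
  have a1 := h.integral_deriv_le ha hab hb
    (F := fun s => localRec' t y dy₀ n s - P (localRec' t y dy₀ n s))
    (F' := fun s => localRec'' t y dy₀ n s - P (localRec'' t y dy₀ n s))
    (fun s => (hasDerivAt_localRec' t y dy₀ hk0 s).sub
      (P.hasFDerivAt.comp_hasDerivAt s (hasDerivAt_localRec' t y dy₀ hk0 s)))
    ((continuous_localRec'' t y dy₀).sub (P.continuous.comp (continuous_localRec'' t y dy₀)))
  -- the evolution error
  have a2 := h.integral_deriv_le ha hab hb (fun s => hasDerivAt_localG t g dg₀ h1 hk0 s)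
    ((continuous_localRec t g dg₀).sub continuous_const)
  -- the data error
  have a3 := h.integral_mean_zero_le hκ ha hab hb (p := fun s => fbar t f n - f s)
    ((memLp_const _).sub hf) (integral_fbar_sub h1 hk0 hfi)
  -- the time reconstruction error
  have a4 := h.integral_mean_zero_le hκ ha hab hb (p := fun s => mu t n s • P D)
    (by
      have hc : Continuous fun s => mu t n s • P D := hcmu.smul continuous_const
      exact (memLp_two_iff_integrable_sq_norm hc.aestronglyMeasurable).2
        (hc.norm.pow 2).integrableOn_Ioc)
    (by rw [intervalIntegral.integral_smul_const, integral_mu, zero_smul])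
  -- The splitting of the residual produces P∂²Uⁿ, the indicator has ∂²Uⁿ; P is a contraction.
  have a4' : √(∫ s in (t (n - 1))..(t n), (t n - t (n - 1)) ^ 3 * ‖mu t n s • P D‖ ^ 2)
      ≤ √(∫ s in (t (n - 1))..(t n), step t n ^ 3 * ‖mu t n s • D‖ ^ 2) := by
    refine Real.sqrt_le_sqrt (intervalIntegral.integral_mono_on hab ?_ ?_ fun s _ => ?_)
    · exact Continuous.intervalIntegrable (by fun_prop) _ _
    · exact Continuous.intervalIntegrable (by fun_prop) _ _
    · rw [norm_smul, norm_smul, ← step]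
      have := hP D
      gcongr
  have i1 : IntervalIntegrable
      (fun s => ⟪localRec'' t y dy₀ n s - P (localRec'' t y dy₀ n s), ζ s⟫)
      volume (t (n - 1)) (t n) :=
    intervalIntegrable_bilin_left (ip X) hab (((continuous_localRec'' t y dy₀).sub
      (P.continuous.comp (continuous_localRec'' t y dy₀))).intervalIntegrable _ _) hζ
  have i2 : IntervalIntegrable (fun s => ⟪localRec t g dg₀ n s - g n, ζ s⟫)
      volume (t (n - 1)) (t n) :=
    intervalIntegrable_bilin_left (ip X) hab
      (((continuous_localRec t g dg₀).sub continuous_const).intervalIntegrable _ _) hζ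
  have i3 : IntervalIntegrable (fun s => ⟪fbar t f n - f s, ζ s⟫) volume (t (n - 1)) (t n) :=
    intervalIntegrable_bilin_left (ip X) hab (intervalIntegrable_const.sub hfi) hζ
  have i4 : IntervalIntegrable (fun s => ⟪mu t n s • P D, ζ s⟫) volume (t (n - 1)) (t n) :=
    intervalIntegrable_bilin_left (ip X) hab
      ((hcmu.smul continuous_const).intervalIntegrable _ _) hζ
  -- Since gⁿ = f̄ⁿ - P∂²Uⁿ, the subtracted P U_tt = (1 + μⁿ)P∂²Uⁿ is restored by gⁿ up to the terms
  -- f̄ⁿ and μⁿP∂²Uⁿ.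
  have hsplit : ∫ s in (t (n - 1))..(t n),
        ⟪localRec'' t y dy₀ n s + localRec t g dg₀ n s - f s, ζ s⟫
      = (∫ s in (t (n - 1))..(t n), ⟪localRec'' t y dy₀ n s - P (localRec'' t y dy₀ n s), ζ s⟫)
        + (∫ s in (t (n - 1))..(t n), ⟪localRec t g dg₀ n s - g n, ζ s⟫)
        + (∫ s in (t (n - 1))..(t n), ⟪fbar t f n - f s, ζ s⟫)
        + ∫ s in (t (n - 1))..(t n), ⟪mu t n s • P D, ζ s⟫ := by
    rw [← intervalIntegral.integral_add i1 i2, ← intervalIntegral.integral_add (i1.add i2) i3,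
      ← intervalIntegral.integral_add ((i1.add i2).add i3) i4]
    refine intervalIntegral.integral_congr fun s _ => ?_
    simp only [← inner_add_left]
    congr 1
    rw [hg, localRec'', ← hD, map_add, map_smul]
    abel
  simp only [localRec'_right, localRec'_left t y dy₀ hk0] at a1
  rw [localG_right, localG_left t g dg₀ h1 hk0, inner_neg_left, inner_neg_left] at a2
  rw [← step] at a3
  have a5 := mul_le_mul_of_nonneg_left
    (mul_le_mul_of_nonneg_left a4' (show 0 ≤ 1 / Real.pi by positivity)) hκ
  rw [hsplit]
  linarith

/-- Testing the residual of the reconstructed discrete solution. -/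
theorem residual_le {N : ℕ} (hN : 1 ≤ N) (ht0 : t 0 = 0) (ht : ∀ n < N, t n < t (n + 1))
    (hf : IsL2Time (t N) f) {P : ℕ → X →L[ℝ] X} (hP : ∀ n v, ‖P n v‖ ≤ ‖v‖) (y g : ℕ → X)
    (dy₀ dg₀ : X) (hg : ∀ n, 1 ≤ n → n ≤ N → g n = -P n (bdiff2 t y dy₀ n) + fbar t f n)
    (h : IsTest (t N) κ ζ ζ') (hκ : 0 ≤ κ) :
    ∫ s in (0 : ℝ)..(t N),
        ⟪pw t N (localRec'' t y dy₀) s + pw t N (localRec t g dg₀) s - f s, ζ s⟫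
      ≤ κ * ((∑ n ∈ Finset.Icc 1 N, ∫ s in (t (n - 1))..(t n),
            ‖localRec' t y dy₀ n s - P n (localRec' t y dy₀ n s)‖)
          + (∑ n ∈ Finset.Icc 1 (N - 1),
              (t N - t n) * ‖P (n + 1) (bdiff t y dy₀ n) - P n (bdiff t y dy₀ n)‖
            + t N * ‖dy₀ - P 1 dy₀‖)
          + (∫ s in (0 : ℝ)..(t N), ‖evolG t N g dg₀ s‖)
          + (∑ n ∈ Finset.Icc 1 N, 1 / Real.pi
              * √(∫ s in (t (n - 1))..(t n), step t n ^ 3 * ‖fbar t f n - f s‖ ^ 2))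
          + ∑ n ∈ Finset.Icc 1 N, 1 / Real.pi
              * √(∫ s in (t (n - 1))..(t n), step t n ^ 3 * ‖mu t n s • bdiff2 t y dy₀ n‖ ^ 2)) := by
  have hnode : ∀ n ≤ N, 0 ≤ t n := fun n hn => ht0 ▸ nodes_mono ht (Nat.zero_le n) hn
  have hT : 0 ≤ t N := hnode N le_rfl
  have hsub : ∀ n, 1 ≤ n → n ≤ N → uIcc (t (n - 1)) (t n) ⊆ uIcc 0 (t N) := fun n _ hn => by
    rw [uIcc_of_le hT]
    exact uIcc_subset_Icc ⟨hnode _ (by omega), nodes_mono ht (by omega) le_rfl⟩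
      ⟨hnode _ hn, nodes_mono ht hn le_rfl⟩
  have hfi : IntervalIntegrable f volume 0 (t N) :=
    (intervalIntegrable_iff_integrableOn_Ioc_of_le hT).2 (hf.integrable one_le_two)
  have hRi : IntervalIntegrable
      (fun s => ⟪pw t N (localRec'' t y dy₀) s + pw t N (localRec t g dg₀) s - f s, ζ s⟫)
      volume 0 (t N) :=
    intervalIntegrable_bilin_left (ip X) hT
      (((integrable_pw_of_continuous _ fun n => continuous_localRec'' t y dy₀).intervalIntegrable.add
        (integrable_pw_of_continuous _ fun n => continuous_localRec t g dg₀).intervalIntegrable).sub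
        hfi) (h.continuousOn hT)
  have hsum := sum_integral_nodes _ N fun n h1 hn => hRi.mono_set (hsub n h1 hn)
  rw [ht0] at hsum
  have hloc : ∀ n ∈ Finset.Icc 1 N, ∫ s in (t (n - 1))..(t n),
        ⟪pw t N (localRec'' t y dy₀) s + pw t N (localRec t g dg₀) s - f s, ζ s⟫
      = ∫ s in (t (n - 1))..(t n), ⟪localRec'' t y dy₀ n s + localRec t g dg₀ n s - f s, ζ s⟫ := by
    intro n hn
    rw [Finset.mem_Icc] at hn
    have hab := (sub_pos.1 (step_pos ht hn.1 hn.2)).le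
    rw [intervalIntegral.integral_of_le hab, intervalIntegral.integral_of_le hab]
    refine setIntegral_congr_fun measurableSet_Ioc fun s hs => ?_
    simp only [pw_apply ht _ hn.1 hn.2 hs]
  have hG : ∫ s in (0 : ℝ)..(t N), ‖evolG t N g dg₀ s‖
      = ∑ n ∈ Finset.Icc 1 N, ∫ s in (t (n - 1))..(t n), ‖localG t g dg₀ n s‖ := by
    have hGi : Integrable (evolG t N g dg₀) :=
      integrable_pw_of_continuous (localG t g dg₀) fun n => continuous_localG t g dg₀
    have := sum_integral_nodes (t := t) (fun s => ‖evolG t N g dg₀ s‖) N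
      fun n _ _ => hGi.norm.intervalIntegrable
    rw [ht0] at this
    rw [← this]
    refine Finset.sum_congr rfl fun n hn => ?_
    rw [Finset.mem_Icc] at hn
    have hab := (sub_pos.1 (step_pos ht hn.1 hn.2)).le
    rw [intervalIntegral.integral_of_le hab, intervalIntegral.integral_of_le hab]
    refine setIntegral_congr_fun measurableSet_Ioc fun s hs => ?_
    simp only [evolG_eq_pw, pw_apply ht _ hn.1 hn.2 hs]
  have hbd := sum_change_le (P := P) (D := bdiff t y dy₀) (Z := fun n => ζ (t n)) hN
    (κ := κ) (t := t) fun n hn => h.norm_apply_le ⟨hnode n hn, nodes_mono ht hn le_rfl⟩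
  -- The sum telescopes by continuity of 𝒢 at the nodes; the ends vanish because γ₀ = 0 and ζ(tᴺ) =
  -- 0.
  have htel : ∑ n ∈ Finset.Icc 1 N,
      (⟪gam t g dg₀ (n - 1), ζ (t (n - 1))⟫ - ⟪gam t g dg₀ n, ζ (t n)⟫) = 0 := by
    have : ∀ M, ∑ n ∈ Finset.Icc 1 M,
        (⟪gam t g dg₀ (n - 1), ζ (t (n - 1))⟫ - ⟪gam t g dg₀ n, ζ (t n)⟫)
        = -⟪gam t g dg₀ M, ζ (t M)⟫ := by
      intro M
      induction M with
      | zero => simp [gam]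
      | succ M ih =>
        rw [Finset.sum_Icc_succ_top (by omega), ih, Nat.add_sub_cancel]
        ring
    rw [this, h.final, inner_zero_right, neg_zero]
  rw [← hsum, Finset.sum_congr rfl hloc]
  refine (Finset.sum_le_sum fun n hn => residual_interval_le h hκ (Finset.mem_Icc.1 hn).1
    (hnode _ (by have := Finset.mem_Icc.1 hn; omega))
    (step_pos ht (Finset.mem_Icc.1 hn).1 (Finset.mem_Icc.1 hn).2)
    (nodes_mono ht (Finset.mem_Icc.1 hn).2 le_rfl)
    (hf.mono_measure (Measure.restrict_mono (Ioc_subset_Ioc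
      (hnode _ (by have := Finset.mem_Icc.1 hn; omega))
      (nodes_mono ht (Finset.mem_Icc.1 hn).2 le_rfl)) le_rfl)) (hP n) y g dy₀ dg₀
    (hg n (Finset.mem_Icc.1 hn).1 (Finset.mem_Icc.1 hn).2)).trans ?_
  rw [Finset.sum_add_distrib, Finset.sum_add_distrib, htel, ← Finset.mul_sum,
    Finset.sum_add_distrib, Finset.sum_add_distrib, Finset.sum_add_distrib, hG]
  have hd0 : bdiff t y dy₀ 0 = dy₀ := rfl
  rw [hd0, ht0, sub_zero] at hbd
  linarith

end Residual

/-! ### The global time reconstruction and its linearity -/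

section Reconstruction

variable {X Y : Type*} [NormedAddCommGroup X] [NormedSpace ℝ X] [NormedAddCommGroup Y]
  [NormedSpace ℝ Y]

lemma map_bdiff (L : X →L[ℝ] Y) (t : ℕ → ℝ) (x : ℕ → X) (dx₀ : X) (n : ℕ) :
    L (bdiff t x dx₀ n) = bdiff t (fun n => L (x n)) (L dx₀) n := by
  unfold bdiff
  split_ifs <;> simp

lemma map_bdiff2 (L : X →L[ℝ] Y) (t : ℕ → ℝ) (x : ℕ → X) (dx₀ : X) (n : ℕ) :
    L (bdiff2 t x dx₀ n) = bdiff2 t (fun n => L (x n)) (L dx₀) n := by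
  simp [bdiff2, map_bdiff]

lemma map_localRec (L : X →L[ℝ] Y) (t : ℕ → ℝ) (x : ℕ → X) (dx₀ : X) (n : ℕ) (s : ℝ) :
    L (localRec t x dx₀ n s) = localRec t (fun n => L (x n)) (L dx₀) n s := by
  simp [localRec, map_bdiff2]

lemma localRec_congr {t : ℕ → ℝ} {x y : ℕ → X} (dx₀ : X) {n : ℕ} (h : ∀ m ≤ n, x m = y m)
    (s : ℝ) : localRec t x dx₀ n s = localRec t y dx₀ n s := by
  have hb : ∀ m ≤ n, bdiff t x dx₀ m = bdiff t y dx₀ m := fun m hm => by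
    rw [bdiff, bdiff, h m hm, h (m - 1) (by omega)]
  rw [localRec, localRec, bdiff2, bdiff2, h n le_rfl, h (n - 1) (by omega), hb n le_rfl,
    hb (n - 1) (by omega)]

variable {t : ℕ → ℝ} {N : ℕ}

lemma timeRec_apply (ht : ∀ n < N, t n < t (n + 1)) (ht0 : t 0 = 0) (x : ℕ → X) (dx₀ : X) {n : ℕ}
    (h1 : 1 ≤ n) (hn : n ≤ N) {s : ℝ} (hs : s ∈ Ioc (t (n - 1)) (t n)) :
    timeRec t N x dx₀ s = localRec t x dx₀ n s := by
  have h0 : 0 < s := by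
    have := nodes_mono ht (Nat.zero_le (n - 1)) (by omega)
    rw [ht0] at this
    exact this.trans_lt hs.1
  rw [timeRec_of_pos _ _ _ _ h0, pw_apply ht _ h1 hn hs]

lemma map_timeRec (ht : ∀ n < N, t n < t (n + 1)) (ht0 : t 0 = 0) (L : X →L[ℝ] Y) (x : ℕ → X)
    (dx₀ : X) {s : ℝ} (hs : s ∈ Icc 0 (t N)) :
    L (timeRec t N x dx₀ s) = timeRec t N (fun n => L (x n)) (L dx₀) s := by
  rcases hs.1.eq_or_lt with h | h
  · simp [← h, timeRec]
  · obtain ⟨n, h1, hn, hm⟩ := exists_interval (t := t) (N := N) (s := s) ⟨ht0 ▸ h, hs.2⟩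
    rw [timeRec_apply ht ht0 _ _ h1 hn hm, timeRec_apply ht ht0 _ _ h1 hn hm, map_localRec]

lemma timeRec_congr (ht : ∀ n < N, t n < t (n + 1)) (ht0 : t 0 = 0) {x y : ℕ → X} (dx₀ : X)
    (hxy : ∀ n ≤ N, x n = y n) {s : ℝ} (hs : s ∈ Ioc 0 (t N)) :
    timeRec t N x dx₀ s = timeRec t N y dx₀ s := by
  obtain ⟨n, h1, hn, hm⟩ := exists_interval (t := t) (N := N) (s := s) ⟨ht0 ▸ hs.1, hs.2⟩
  rw [timeRec_apply ht ht0 _ _ h1 hn hm, timeRec_apply ht ht0 _ _ h1 hn hm]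
  exact localRec_congr dx₀ (fun m hmn => hxy m (hmn.trans hn)) s

lemma ae_hasDerivAt_timeRec (ht : ∀ n < N, t n < t (n + 1)) (ht0 : t 0 = 0) (x : ℕ → X)
    (dx₀ : X) :
    ∀ᵐ s ∂(volume.restrict (Ioc 0 (t N))),
      HasDerivAt (timeRec t N x dx₀) (pw t N (localRec' t x dx₀) s) s := by
  rw [← ht0]
  filter_upwards [ae_exists_Ioo (t := t) (N := N), ae_restrict_mem measurableSet_Ioc]
    with s ⟨n, h1, hn, hs⟩ hs0
  rw [pw_apply ht _ h1 hn ⟨hs.1, hs.2.le⟩]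
  refine (hasDerivAt_localRec t x dx₀ h1 s).congr_of_eventuallyEq ?_
  filter_upwards [isOpen_Ioo.mem_nhds hs] with r hr
  exact timeRec_apply ht ht0 x dx₀ h1 hn ⟨hr.1, hr.2.le⟩

/-- The final node is excluded as a null set: past it the reconstruction is zero, so the identity is
differentiated only inside the time interval. -/
lemma ae_hasDerivAt_map_timeRec (ht : ∀ n < N, t n < t (n + 1)) (ht0 : t 0 = 0) (L : X →L[ℝ] Y)
    (x : ℕ → X) (dx₀ : X) :
    ∀ᵐ s ∂(volume.restrict (Ioc 0 (t N))), HasDerivAt (fun s => L (timeRec t N x dx₀ s))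
      (pw t N (localRec' t (fun n => L (x n)) (L dx₀)) s) s := by
  have h0 : ∀ᵐ s : ℝ, s ≠ t N := (Set.countable_singleton (t N)).ae_notMem volume
  filter_upwards [ae_hasDerivAt_timeRec ht ht0 (fun n => L (x n)) (L dx₀), ae_restrict_of_ae h0,
    ae_restrict_mem measurableSet_Ioc] with s hs hsN hs'
  refine hs.congr_of_eventuallyEq ?_
  filter_upwards [isOpen_Ioo.mem_nhds ⟨hs'.1, lt_of_le_of_ne hs'.2 hsN⟩] with r hr
  exact map_timeRec ht ht0 L x dx₀ (Ioo_subset_Icc_self hr)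

variable [CompleteSpace X]

lemma timeRec_eq_integral (hN : 1 ≤ N) (ht : ∀ n < N, t n < t (n + 1)) (ht0 : t 0 = 0) (x : ℕ → X)
    (dx₀ : X) {s : ℝ} (hs : s ∈ Icc 0 (t N)) :
    timeRec t N x dx₀ s = x 0 + ∫ r in (0 : ℝ)..s, pw t N (localRec' t x dx₀) r := by
  rcases hs.1.eq_or_lt with h | h
  · simp [← h, timeRec]
  · have key := pw_eq_integral ht (localRec t x dx₀) (localRec' t x dx₀)
      (fun n h1 _ s => hasDerivAt_localRec t x dx₀ h1 s) (fun n => continuous_localRec' t x dx₀)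
      (fun n h1 hn => by
        have h2 := localRec_left t x dx₀ (n := n + 1) (step_pos ht (by omega) hn).ne'
        rw [Nat.add_sub_cancel] at h2
        rw [h2, localRec_right t x dx₀ (step_pos ht h1 hn.le).ne'])
      (s := s) ⟨ht0 ▸ h, hs.2⟩
    have h3 := localRec_left t x dx₀ (n := 1) (step_pos ht le_rfl hN).ne'
    rw [Nat.sub_self] at h3
    rw [timeRec_of_pos _ _ _ _ h, key, h3, ht0]

lemma continuousOn_timeRec (hN : 1 ≤ N) (ht : ∀ n < N, t n < t (n + 1)) (ht0 : t 0 = 0) (x : ℕ → X)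
    (dx₀ : X) : ContinuousOn (timeRec t N x dx₀) (Icc 0 (t N)) := by
  have h1 : ContinuousOn (fun s => x 0 + ∫ r in (0 : ℝ)..s, pw t N (localRec' t x dx₀) r)
      (Icc 0 (t N)) :=
    continuousOn_const.add (continuousOn_primitive_Icc (ht0 ▸ nodes_mono ht (Nat.zero_le N) le_rfl)
      (integrable_pw_of_continuous _ fun n => continuous_localRec' t x dx₀).intervalIntegrable)
  exact h1.congr fun s hs => timeRec_eq_integral hN ht ht0 x dx₀ hs

/-- The second derivative may jump at the nodes, so the relation is kept in integrated form, the
form in which weak time derivatives are used. -/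
lemma pw_localRec'_eq_integral (hN : 1 ≤ N) (ht : ∀ n < N, t n < t (n + 1)) (ht0 : t 0 = 0)
    (x : ℕ → X) (dx₀ : X) {s : ℝ} (hs : s ∈ Ioc 0 (t N)) :
    pw t N (localRec' t x dx₀) s
      = dx₀ + ∫ r in (0 : ℝ)..s, pw t N (localRec'' t x dx₀) r := by
  have key := pw_eq_integral ht (localRec' t x dx₀) (localRec'' t x dx₀)
    (fun n h1 hn s => hasDerivAt_localRec' t x dx₀ (step_pos ht h1 hn).ne' s)
    (fun n => continuous_localRec'' t x dx₀)
    (fun n h1 hn => by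
      have h2 := localRec'_left t x dx₀ (n := n + 1) (step_pos ht (by omega) hn).ne'
      rw [Nat.add_sub_cancel] at h2
      rw [h2, localRec'_right])
    (s := s) ⟨ht0 ▸ hs.1, hs.2⟩
  have h3 := localRec'_left t x dx₀ (n := 1) (step_pos ht le_rfl hN).ne'
  rw [Nat.sub_self] at h3
  rw [key, h3, ht0]
  rfl

end Reconstruction

/-! ### The embedding into the dual space -/

section Transpose

variable {H X : Type*} [NormedAddCommGroup H] [InnerProductSpace ℝ H]
  [NormedAddCommGroup X] [InnerProductSpace ℝ X]

/-- The transpose `x ↦ (v ↦ ⟨x, J v⟩)` of a continuous linear map. -/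
def transpose (J : H →L[ℝ] X) : X →L[ℝ] StrongDual ℝ H :=
  ((ContinuousLinearMap.compL ℝ H X ℝ).flip J).comp (ip X)

lemma transpose_apply (J : H →L[ℝ] X) (x : X) : transpose J x = (innerSL ℝ x).comp J := rfl

end Transpose

/-! ### The pointwise form of the scheme -/

section Scheme

variable {d : ℕ} {Ω : Set (EuclideanSpace ℝ (Fin d))}

lemma norm_proj_le (V : Submodule ℝ (H10 Ω)) [FiniteDimensional ℝ V] (v : L2 Ω) :
    ‖proj V v‖ ≤ ‖v‖ :=
  Submodule.norm_starProjection_apply_le _ _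

lemma inner_proj (V : Submodule ℝ (H10 Ω)) [FiniteDimensional ℝ V] (v : L2 Ω) (χ : V) :
    ⟪proj V v, incl Ω χ⟫ = ⟪v, incl Ω χ⟫ := by
  have hχ : incl Ω χ ∈ V.map (incl Ω : H10 Ω →ₗ[ℝ] L2 Ω) := ⟨χ, χ.2, rfl⟩
  rw [proj, Submodule.inner_starProjection_left_eq_right,
    Submodule.starProjection_eq_self_iff.2 hχ]

/-- The pointwise form of the scheme: `gⁿ = f̄ⁿ - Πⁿ ∂²Uⁿ`. -/
lemma gRec_eq {a : EuclideanSpace ℝ (Fin d) → ℝ} {t : ℕ → ℝ} {N : ℕ}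
    {V : ℕ → Submodule ℝ (H10 Ω)} [∀ n, FiniteDimensional ℝ (V n)] {π₀ : L2 Ω →ₗ[ℝ] V 0}
    {f : ℝ → L2 Ω} {u₀ : H10 Ω} {u₁ : L2 Ω} {U : (n : ℕ) → V n}
    (hU : IsDiscreteSolution a t N V π₀ f u₀ u₁ U) {A : (n : ℕ) → V n →ₗ[ℝ] V n}
    (hA : ∀ n ≤ N, IsDiscreteEllipticOp a (V n) (A n)) {n : ℕ} (h1 : 1 ≤ n) (hn : n ≤ N) :
    gRec t V A f U n
      = -proj (V n) (bdiff2 t (fun j => incl Ω (U j)) (incl Ω (π₀ u₁ : H10 Ω)) n)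
        + fbar t f n := by
  rw [← map_bdiff2 (incl Ω) t (fun j => (U j : H10 Ω)), gRec]
  congr 1
  rw [eq_neg_iff_add_eq_zero]
  set D := bdiff2 t (fun j => (U j : H10 Ω)) (π₀ u₁ : H10 Ω) n
  -- AⁿUⁿ - Πⁿfⁿ + Πⁿ∂²Uⁿ lies in the discrete space and, by the scheme, is orthogonal to it;
  -- testing with itself shows that it is zero.
  have hmem : incl Ω (A n (U n)) - proj (V n) (f (t n)) + proj (V n) (incl Ω D)
      ∈ (V n).map (incl Ω : H10 Ω →ₗ[ℝ] L2 Ω) :=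
    add_mem (sub_mem ⟨_, (A n (U n)).2, rfl⟩ (Submodule.starProjection_apply_mem _ _))
      (Submodule.starProjection_apply_mem _ _)
  obtain ⟨χ, hχV, hχ⟩ := hmem
  have hχ' : incl Ω χ = incl Ω (A n (U n)) - proj (V n) (f (t n)) + proj (V n) (incl Ω D) := hχ
  have h2 := hU.2 n h1 hn ⟨χ, hχV⟩
  have h3 := hA n hn (U n) ⟨χ, hχV⟩
  have h4 := inner_proj (V n) (f (t n)) ⟨χ, hχV⟩
  have h5 := inner_proj (V n) (incl Ω D) ⟨χ, hχV⟩
  have h6 : ⟪incl Ω χ, incl Ω χ⟫ = 0 := by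
    nth_rw 1 [hχ']
    rw [inner_add_left, inner_sub_left]
    simp only at h2 h3 h4 h5
    rw [h3, h4, h5]
    linarith
  rw [← hχ', inner_self_eq_zero.1 h6]

end Scheme

/-! ### The abstract estimate for the difference of w and u -/

lemma IsL2Time.intervalIntegrable {X : Type*} [NormedAddCommGroup X] {T : ℝ} (hT : 0 ≤ T)
    {x : ℝ → X} (hx : IsL2Time T x) : IntervalIntegrable x volume 0 T :=
  (intervalIntegrable_iff_integrableOn_Ioc_of_le hT).2 (MemLp.integrable one_le_two hx)

/-- The estimate of `w - u` in `L∞(0,T;X)` for reconstructions of a discrete solution of the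
abstract wave equation. -/
theorem elliptic_error_bound {H X : Type*} [NormedAddCommGroup H] [InnerProductSpace ℝ H]
    [CompleteSpace H] [NormedAddCommGroup X] [InnerProductSpace ℝ X] [CompleteSpace X]
    (J : H →L[ℝ] X) (b : H →L[ℝ] H →L[ℝ] ℝ) (hs : ∀ z v, b z v = b v z)
    (hb0 : ∀ v, 0 ≤ b v v) {c C : ℝ} (hc : 0 < c)
    (hb : ∀ v, c * ‖v‖ ^ 2 ≤ c * ‖J v‖ ^ 2 + b v v) (hC0 : 0 ≤ C)
    (hC : ∀ v, ‖J v‖ ^ 2 ≤ C * b v v) {t : ℕ → ℝ} {N : ℕ} (hN : 1 ≤ N)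
    (ht0 : t 0 = 0) (ht : ∀ n < N, t n < t (n + 1)) {f : ℝ → X} (hf : IsL2Time (t N) f)
    {u₀ : H} {u₁ : X} {u : ℝ → H} {ut : ℝ → X} {utt : ℝ → StrongDual ℝ H}
    (hu2 : IsL2Time (t N) u) (hut2 : IsL2Time (t N) ut) (hutt2 : IsL2Time (t N) utt)
    (hut : HasTimeDeriv (t N) (fun s => J (u s)) (J u₀) ut)
    (hutt : HasTimeDeriv (t N) (fun s => transpose J (ut s)) (transpose J u₁) utt)
    (hueq : ∀ᵐ s ∂(volume.restrict (Ioc 0 (t N))), ∀ v, utt s v + b (u s) v = ⟪f s, J v⟫)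
    {y : ℕ → H} {dy₀ : H} {g : ℕ → X} {dg₀ : X} {w : ℕ → H} {dw₀ : H}
    (hw : ∀ n ≤ N, ∀ v, b (w n) v = ⟪g n, J v⟫) (hdw₀ : ∀ v, b dw₀ v = ⟪dg₀, J v⟫)
    {P : ℕ → X →L[ℝ] X} (hP : ∀ n v, ‖P n v‖ ≤ ‖v‖)
    (hg : ∀ n, 1 ≤ n → n ≤ N →
      g n = -P n (bdiff2 t (fun j => J (y j)) (J dy₀) n) + fbar t f n) :
    ∀ᵐ τ ∂(volume.restrict (Ioc 0 (t N))),
      ‖J (timeRec t N w dw₀ τ - u τ)‖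
        ≤ ‖J (w 0) - J u₀‖
          + (∫ s in (0 : ℝ)..(t N), ‖pw t N (localRec' t (fun j => J (w j)) (J dw₀)) s
              - pw t N (localRec' t (fun j => J (y j)) (J dy₀)) s‖)
          + min (t N) √C * ‖J dy₀ - u₁‖
          + ((∑ n ∈ Finset.Icc 1 N, ∫ s in (t (n - 1))..(t n),
              ‖localRec' t (fun j => J (y j)) (J dy₀) n s
                - P n (localRec' t (fun j => J (y j)) (J dy₀) n s)‖)
            + (∑ n ∈ Finset.Icc 1 (N - 1), (t N - t n)
                  * ‖P (n + 1) (bdiff t (fun j => J (y j)) (J dy₀) n)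
                    - P n (bdiff t (fun j => J (y j)) (J dy₀) n)‖
              + t N * ‖J dy₀ - P 1 (J dy₀)‖)
            + (∫ s in (0 : ℝ)..(t N), ‖evolG t N g dg₀ s‖)
            + (∑ n ∈ Finset.Icc 1 N, 1 / Real.pi
                * √(∫ s in (t (n - 1))..(t n), step t n ^ 3 * ‖fbar t f n - f s‖ ^ 2))
            + ∑ n ∈ Finset.Icc 1 N, 1 / Real.pi
                * √(∫ s in (t (n - 1))..(t n), step t n ^ 3
                  * ‖mu t n s • bdiff2 t (fun j => J (y j)) (J dy₀) n‖ ^ 2)) := by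
  set yL : ℕ → X := fun j => J (y j) with hyL
  set wL : ℕ → X := fun j => J (w j) with hwL
  have hT : 0 ≤ t N := ht0 ▸ nodes_mono ht (Nat.zero_le N) le_rfl
  -- the reconstructions as primitives
  have hiU' := integrable_pw_of_continuous (t := t) (N := N) (localRec' t yL (J dy₀))
    fun n => continuous_localRec' t yL _
  have hiU'' := integrable_pw_of_continuous (t := t) (N := N) (localRec'' t yL (J dy₀))
    fun n => continuous_localRec'' t yL _
  have hiw' := integrable_pw_of_continuous (t := t) (N := N) (localRec' t wL (J dw₀))
    fun n => continuous_localRec' t wL _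
  have hiwH := integrable_pw_of_continuous (t := t) (N := N) (localRec t w dw₀)
    fun n => continuous_localRec t w _
  have hig := integrable_pw_of_continuous (t := t) (N := N) (localRec t g dg₀)
    fun n => continuous_localRec t g _
  have hwH : IntervalIntegrable (timeRec t N w dw₀) volume 0 (t N) := by
    refine hiwH.intervalIntegrable.congr ?_
    intro s hs
    rw [uIoc_of_le hT] at hs
    exact (timeRec_of_pos t w dw₀ N hs.1).symm
  refine dual_stability J b hs hb0 hc hb hC0 hC
    (ρ := fun s => timeRec t N w dw₀ s - u s)
    (q := fun s => pw t N (localRec' t yL (J dy₀)) s - ut s)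
    (ε' := fun s => pw t N (localRec' t wL (J dw₀)) s
      - pw t N (localRec' t yL (J dy₀)) s)
    (R := fun s => pw t N (localRec'' t yL (J dy₀)) s + pw t N (localRec t g dg₀) s - f s)
    (e'' := fun s => transpose J (pw t N (localRec'' t yL (J dy₀)) s) - utt s)
    (hwH.sub (hu2.intervalIntegrable hT))
    (hiU'.intervalIntegrable.sub (hut2.intervalIntegrable hT))
    (hiw'.intervalIntegrable.sub hiU'.intervalIntegrable)
    ((hiU''.intervalIntegrable.add hig.intervalIntegrable).sub (hf.intervalIntegrable hT))
    ((((transpose J).integrable_comp hiU'').intervalIntegrable).sub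
      (hutt2.intervalIntegrable hT)) ?_ ?_ ?_ ?_
  · filter_upwards [hut, ae_restrict_mem measurableSet_Ioc] with s hs' hsT
    have hsub : uIcc 0 s ⊆ uIcc 0 (t N) := by
      rw [uIcc_of_le hT]
      exact uIcc_subset_Icc ⟨le_rfl, hT⟩ (Ioc_subset_Icc_self hsT)
    have h1 : J (timeRec t N w dw₀ s)
        = J (w 0) + ∫ r in (0 : ℝ)..s, pw t N (localRec' t wL (J dw₀)) r := by
      rw [map_timeRec ht ht0 _ _ _ (Ioc_subset_Icc_self hsT),
        timeRec_eq_integral hN ht ht0 _ _ (Ioc_subset_Icc_self hsT)]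
    rw [map_sub, h1, hs']
    -- The discrete velocity cancels in (U_t - u_t) + (w_t - U_t). The split matters because only
    -- the first part has a second derivative governed by the equation.
    simp only [sub_add_sub_cancel']
    rw [intervalIntegral.integral_sub hiw'.intervalIntegrable
      ((hut2.intervalIntegrable hT).mono_set hsub)]
    abel
  · filter_upwards [hutt, ae_restrict_mem measurableSet_Ioc] with s hs' hsT
    have hsub : uIcc 0 s ⊆ uIcc 0 (t N) := by
      rw [uIcc_of_le hT]
      exact uIcc_subset_Icc ⟨le_rfl, hT⟩ (Ioc_subset_Icc_self hsT)
    rw [← transpose_apply, ← transpose_apply, map_sub, map_sub,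
      pw_localRec'_eq_integral hN ht ht0 _ _ hsT, map_add, intervalIntegral.integral_sub
        ((transpose J).integrable_comp hiU'').intervalIntegrable
        ((hutt2.intervalIntegrable hT).mono_set hsub),
      (transpose J).intervalIntegral_comp_comm hiU''.intervalIntegrable]
    have h1 : transpose J (ut s) = transpose J u₁ + ∫ r in (0 : ℝ)..s, utt r := hs'
    rw [h1]
    abel
  · filter_upwards [hueq, ae_restrict_mem measurableSet_Ioc] with s hs' hsT v
    -- Time reconstruction commutes with the functionals b(·, v) and ⟨·, Jv⟩, so the elliptic
    -- identity extends from the nodes to all times; the separate equation for ∂w⁰ is needed on the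
    -- first interval.
    have h1 : b (timeRec t N w dw₀ s) v = ⟪pw t N (localRec t g dg₀) s, J v⟫ := by
      have e1 := map_timeRec ht ht0 (b.flip v) w dw₀ (Ioc_subset_Icc_self hsT)
      have e2 := map_timeRec ht ht0 ((ip X).flip (J v)) g dg₀ (Ioc_subset_Icc_self hsT)
      simp only [ContinuousLinearMap.flip_apply, ip_apply] at e1 e2
      rw [← timeRec_of_pos _ _ _ _ hsT.1, e2, e1, hdw₀ v]
      exact timeRec_congr ht ht0 _ (fun n hn => hw n hn v) hsT
    have h2 := hs' v
    simp only [map_sub, sub_apply, transpose_apply, ContinuousLinearMap.comp_apply,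
      innerSL_apply_apply, h1, inner_sub_left, inner_add_left]
    linarith
  · intro κ ζ ζ' hκ hζ
    exact residual_le hN ht0 ht hf hP yL g _ dg₀ hg hζ hκ

/-! ### The indicators at the final time -/

section ErrorBound

variable {d : ℕ} {Ω : Set (EuclideanSpace ℝ (Fin d))} {t : ℕ → ℝ} {N : ℕ}

/-- At τ = tᴺ the partial last interval is complete and joins the sum; nodes, where `deriv` could be
a default value, form a null set. -/
lemma eta1_eq (hN : 1 ≤ N) (ht : ∀ n < N, t n < t (n + 1)) (ht0 : t 0 = 0)
    (V : ℕ → Submodule ℝ (H10 Ω)) [∀ n, FiniteDimensional ℝ (V n)] (y : ℕ → L2 Ω) (dy₀ : L2 Ω)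
    {Ut : ℝ → L2 Ω} (hUt : ∀ᵐ s ∂(volume.restrict (Ioc 0 (t N))),
      HasDerivAt Ut (pw t N (localRec' t y dy₀) s) s) :
    eta1 t V y dy₀ Ut N (t N)
      = (∑ n ∈ Finset.Icc 1 N, ∫ s in (t (n - 1))..(t n),
            ‖localRec' t y dy₀ n s - proj (V n) (localRec' t y dy₀ n s)‖)
          + (∑ n ∈ Finset.Icc 1 (N - 1), (t N - t n)
                * ‖proj (V (n + 1)) (bdiff t y dy₀ n) - proj (V n) (bdiff t y dy₀ n)‖
            + t N * ‖dy₀ - proj (V 1) dy₀‖) := by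
  have hsum : ∀ h : ℕ → ℝ, ∑ n ∈ Finset.Icc 1 N, h n = ∑ n ∈ Finset.Icc 1 (N - 1), h n + h N := by
    intro h
    obtain ⟨M, rfl⟩ := Nat.exists_eq_add_of_le' hN
    rw [Finset.sum_Icc_succ_top (by omega), Nat.add_sub_cancel]
  rw [eta1, ← hsum (fun n => ∫ s in (t (n - 1))..(t n), ‖deriv Ut s - proj (V n) (deriv Ut s)‖)]
  congr 1
  refine Finset.sum_congr rfl fun n hn => ?_
  rw [Finset.mem_Icc] at hn
  have hab := (sub_pos.1 (step_pos ht hn.1 hn.2)).le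
  have hsub : Ioc (t (n - 1)) (t n) ⊆ Ioc 0 (t N) :=
    Ioc_subset_Ioc (ht0 ▸ nodes_mono ht (Nat.zero_le _) (by omega)) (nodes_mono ht hn.2 le_rfl)
  rw [intervalIntegral.integral_of_le hab, intervalIntegral.integral_of_le hab]
  refine integral_congr_ae ?_
  filter_upwards [ae_mono (Measure.restrict_mono hsub le_rfl) hUt,
    ae_restrict_mem measurableSet_Ioc] with s hs hs'
  rw [hs.deriv, pw_apply ht _ hn.1 hn.2 hs']

instance completeSpace_H10 (Ω : Set (EuclideanSpace ℝ (Fin d))) : CompleteSpace (H10 Ω) :=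
  (Submodule.isClosed_topologicalClosure _).completeSpace_coe

end ErrorBound

/-- Doubling an indicator puts 1/π on the earlier intervals and 2 on the last, and 1/π ≤ 2. -/
lemma sum_sqrt_le_eta (h : ℕ → ℝ) {N : ℕ} (hN : 1 ≤ N) (hh : ∀ n, 0 ≤ h n) :
    ∑ n ∈ Finset.Icc 1 N, 1 / Real.pi * h n
      ≤ 2 * (1 / (2 * Real.pi) * ∑ n ∈ Finset.Icc 1 (N - 1), h n + h N) := by
  obtain ⟨M, rfl⟩ := Nat.exists_eq_add_of_le' hN
  have hπ : 1 / Real.pi ≤ 2 := by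
    rw [div_le_iff₀ Real.pi_pos]
    linarith [Real.pi_gt_three]
  rw [Finset.sum_Icc_succ_top (by omega), Nat.add_sub_cancel, ← Finset.mul_sum]
  have e : 2 * (1 / (2 * Real.pi) * ∑ n ∈ Finset.Icc 1 M, h n + h (M + 1))
      = 1 / Real.pi * ∑ n ∈ Finset.Icc 1 M, h n + 2 * h (M + 1) := by
    field_simp
  rw [e]
  linarith [mul_le_mul_of_nonneg_right hπ (hh (M + 1))]

/-- An almost everywhere bound by a constant and by a bounded function. -/
lemma toReal_eLpNorm_top_le {α X : Type*} [MeasurableSpace α] {μ : Measure α}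
    [NormedAddCommGroup X] {e ε : α → X} (hε : MemLp ε ∞ μ) (he : AEStronglyMeasurable e μ) {K : ℝ}
    (hK : 0 ≤ K) (h : ∀ᵐ s ∂μ, ‖e s‖ ≤ ‖ε s‖ + K) :
    MemLp e ∞ μ ∧ (eLpNorm e ∞ μ).toReal ≤ (eLpNorm ε ∞ μ).toReal + K := by
  have h1 : ∀ᵐ s ∂μ, ‖e s‖ ≤ (eLpNorm ε ∞ μ).toReal + K := by
    filter_upwards [h, ae_le_eLpNormEssSup (f := ε) (μ := μ)] with s hs hs'
    rw [← eLpNorm_exponent_top] at hs'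
    have := ENNReal.toReal_mono hε.2.ne hs'
    rw [toReal_enorm] at this
    linarith
  refine ⟨memLp_top_of_bound he _ h1, ?_⟩
  rw [eLpNorm_exponent_top (f := e)]
  refine ENNReal.toReal_le_of_le_ofReal (by positivity) (eLpNormEssSup_le_of_ae_bound h1)

end WaveFEM

end

/-! ### The error bound for the wave equation -/

set_option maxHeartbeats 1000000 in
theorem mainTheorem2 {d : ℕ} (hd : 0 < d)
    -- domain, coefficient and data
    (Ω : Set (EuclideanSpace ℝ (Fin d))) (hΩo : IsOpen Ω) (hΩb : Bornology.IsBounded Ω)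
    (a : EuclideanSpace ℝ (Fin d) → ℝ) (ha : ContinuousOn a (closure Ω))
    (αmin αmax : ℝ) (hα : 0 < αmin) (haα : ∀ x ∈ closure Ω, αmin ≤ a x ∧ a x ≤ αmax)
    -- time nodes
    (N : ℕ) (hN : 0 < N) (t : ℕ → ℝ) (ht0 : t 0 = 0) (ht : ∀ n < N, t n < t (n + 1))
    (f : ℝ → WaveFEM.L2 Ω) (hf : WaveFEM.IsL2Time (t N) f)
    (u₀ : WaveFEM.H10 Ω) (u₁ : WaveFEM.L2 Ω)
    -- exact solution
    (u : ℝ → WaveFEM.H10 Ω) (hu : WaveFEM.IsWeakSolution a (t N) f u₀ u₁ u)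
    -- discrete spaces, initial projection, discrete solution
    (V : ℕ → Submodule ℝ (WaveFEM.H10 Ω)) [∀ n, FiniteDimensional ℝ (V n)]
    (π₀ : WaveFEM.L2 Ω →ₗ[ℝ] V 0) (hπ₀ : ∀ χ : V 0, π₀ (WaveFEM.incl Ω χ) = χ)
    (U : (n : ℕ) → V n) (hU : WaveFEM.IsDiscreteSolution a t N V π₀ f u₀ u₁ U)
    -- discrete elliptic operators and elliptic reconstructions
    (A : (n : ℕ) → V n →ₗ[ℝ] V n) (hA : ∀ n ≤ N, WaveFEM.IsDiscreteEllipticOp a (V n) (A n))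
    (w : ℕ → WaveFEM.H10 Ω)
    (hw : ∀ n ≤ N, WaveFEM.IsEllipticSolution a (WaveFEM.gRec t V A f U n) (w n))
    (dw₀ : WaveFEM.H10 Ω)
    (hdw₀ : WaveFEM.IsEllipticSolution a (WaveFEM.dgRec0 V A f (π₀ u₁)) dw₀) :
    let V0 : WaveFEM.H10 Ω := (π₀ u₁ : WaveFEM.H10 Ω)
    let UL : ℕ → WaveFEM.L2 Ω := fun n => WaveFEM.incl Ω (U n)
    let V0L : WaveFEM.L2 Ω := WaveFEM.incl Ω V0
    let Urec : ℝ → WaveFEM.H10 Ω := WaveFEM.timeRec t N (fun n => (U n : WaveFEM.H10 Ω)) V0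
    let wrec : ℝ → WaveFEM.H10 Ω := WaveFEM.timeRec t N w dw₀
    let e : ℝ → WaveFEM.L2 Ω := fun s => WaveFEM.incl Ω (Urec s - u s)
    let ε : ℝ → WaveFEM.L2 Ω := fun s => WaveFEM.incl Ω (wrec s - Urec s)
    let g : ℕ → WaveFEM.L2 Ω := WaveFEM.gRec t V A f U
    let dg₀ : WaveFEM.L2 Ω := WaveFEM.dgRec0 V A f (π₀ u₁)
    let I : MeasureTheory.Measure ℝ := volume.restrict (Set.Ioc 0 (t N))
    MemLp e ∞ I ∧ MemLp ε ∞ I ∧ IntegrableOn (fun s => deriv ε s) (Set.Ioc 0 (t N)) ∧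
    (eLpNorm e ∞ I).toReal ≤
      (eLpNorm ε ∞ I).toReal
      + √2 * (‖WaveFEM.incl Ω u₀ - WaveFEM.incl Ω (Urec 0)‖ + ‖ε 0‖)
      + 2 * ((∫ s in (0 : ℝ)..(t N), ‖deriv ε s‖)
          + (WaveFEM.eta1 t V UL V0L (fun s => WaveFEM.incl Ω (Urec s)) N (t N)
            + WaveFEM.eta2 t N g dg₀ (t N)
            + WaveFEM.eta3 t f N (t N)
            + WaveFEM.eta4 t UL V0L N (t N)))
      + min (2 * t N) √(2 * WaveFEM.poincareConst Ω / αmin) * ‖u₁ - V0L‖ := by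
  intro V0 UL V0L Urec wrec e ε g dg₀ I
  have hT : 0 < t N := ht0 ▸ (ht 0 hN).trans_le (WaveFEM.nodes_mono ht hN le_rfl)
  have hT0 : 0 ≤ t N := hT.le
  -- the bilinear form
  have haΩ : ∀ᵐ x ∂(volume.restrict Ω), αmin ≤ a x ∧ a x ≤ αmax :=
    (ae_restrict_mem hΩo.measurableSet).mono fun x hx => haα x (subset_closure hx)
  have ham : AEStronglyMeasurable a (volume.restrict Ω) :=
    (ha.mono subset_closure).aestronglyMeasurable hΩo.measurableSet
  have haK : ∀ᵐ x ∂(volume.restrict Ω), |a x| ≤ αmax :=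
    haΩ.mono fun x hx => by rw [abs_of_pos (hα.trans_le hx.1)]; exact hx.2
  have hcoer := WaveFEM.mul_grad_sq_le_aForm ham haK (haΩ.mono fun x hx => hx.1)
  obtain ⟨b, hb⟩ := WaveFEM.exists_aForm_bilin ham haK
  obtain ⟨hu2, ut, utt, hut2, hutt2, hut, hutt, hueq⟩ := hu
  have hbs : ∀ z v, b z v = b v z := fun z v => by rw [hb, hb, WaveFEM.aForm_comm]
  have hb0 : ∀ v, 0 ≤ b v v := fun v => by
    rw [hb]
    exact (by positivity : 0 ≤ αmin * ‖WaveFEM.grad Ω v‖ ^ 2).trans (hcoer v)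
  have hbc : ∀ v, αmin * ‖v‖ ^ 2 ≤ αmin * ‖WaveFEM.incl Ω v‖ ^ 2 + b v v := fun v => by
    rw [WaveFEM.norm_sq_eq_incl_add_grad, hb, mul_add]
    linarith [hcoer v]
  have hC0 : 0 ≤ WaveFEM.poincareConst Ω / αmin := div_nonneg WaveFEM.poincareConst_nonneg hα.le
  have hbC : ∀ v, ‖WaveFEM.incl Ω v‖ ^ 2 ≤ WaveFEM.poincareConst Ω / αmin * b v v := fun v => by
    rw [hb, div_mul_eq_mul_div, le_div_iff₀ hα]
    have h1 := WaveFEM.incl_sq_le_poincareConst hd hΩb v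
    have h2 := mul_le_mul_of_nonneg_left (hcoer v) (WaveFEM.poincareConst_nonneg (Ω := Ω))
    nlinarith
  have hueq' : ∀ᵐ s ∂(volume.restrict (Set.Ioc 0 (t N))), ∀ v,
      utt s v + b (u s) v = inner ℝ (f s) (WaveFEM.incl Ω v) := by
    filter_upwards [hueq] with s hs v
    rw [hb]
    exact hs v
  have hbound := WaveFEM.elliptic_error_bound (WaveFEM.incl Ω) b hbs hb0 hα hbc hC0 hbC hN ht0 ht
    hf hu2 hut2 hutt2 hut hutt hueq' (y := fun n => (U n : WaveFEM.H10 Ω)) (dy₀ := V0)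
    (g := g) (dg₀ := dg₀) (w := w) (dw₀ := dw₀) (fun n hn v => by rw [hb]; exact hw n hn v)
    (fun v => by rw [hb]; exact hdw₀ v) (P := fun n => WaveFEM.proj (V n))
    (fun n v => WaveFEM.norm_proj_le (V n) v) (fun n h1 hn => WaveFEM.gRec_eq hU hA h1 hn)
  -- the reconstructions in `L²(Ω)`
  set wL : ℕ → WaveFEM.L2 Ω := fun n => WaveFEM.incl Ω (w n) with hwL
  set U' := WaveFEM.pw t N (WaveFEM.localRec' t UL V0L) with hU'
  set w' := WaveFEM.pw t N (WaveFEM.localRec' t wL (WaveFEM.incl Ω dw₀)) with hw'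
  have hdU : ∀ᵐ s ∂I, HasDerivAt (fun s => WaveFEM.incl Ω (Urec s)) (U' s) s :=
    WaveFEM.ae_hasDerivAt_map_timeRec ht ht0 (WaveFEM.incl Ω) _ _
  have hdw : ∀ᵐ s ∂I, HasDerivAt (fun s => WaveFEM.incl Ω (wrec s)) (w' s) s :=
    WaveFEM.ae_hasDerivAt_map_timeRec ht ht0 (WaveFEM.incl Ω) _ _
  have hε : ∀ s, ε s = WaveFEM.incl Ω (wrec s) - WaveFEM.incl Ω (Urec s) := fun s => map_sub _ _ _
  have hdε : ∀ᵐ s ∂I, deriv ε s = w' s - U' s := by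
    filter_upwards [hdU, hdw] with s h1 h2
    have h3 : HasDerivAt ε (w' s - U' s) s := (h2.sub h1).congr_of_eventuallyEq
      (Filter.Eventually.of_forall hε)
    exact h3.deriv
  have hiU' : Integrable U' := WaveFEM.integrable_pw_of_continuous _
    fun n => WaveFEM.continuous_localRec' t UL V0L
  have hiw' : Integrable w' := WaveFEM.integrable_pw_of_continuous _
    fun n => WaveFEM.continuous_localRec' t wL _
  have hcU : ContinuousOn (fun s => WaveFEM.incl Ω (Urec s)) (Set.Icc 0 (t N)) :=
    (WaveFEM.incl Ω).continuous.comp_continuousOn (WaveFEM.continuousOn_timeRec hN ht ht0 _ _)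
  have hcw : ContinuousOn (fun s => WaveFEM.incl Ω (wrec s)) (Set.Icc 0 (t N)) :=
    (WaveFEM.incl Ω).continuous.comp_continuousOn (WaveFEM.continuousOn_timeRec hN ht ht0 _ _)
  have hcε : ContinuousOn ε (Set.Icc 0 (t N)) := (hcw.sub hcU).congr fun s _ => hε s
  have hεmem : MemLp ε ∞ I := by
    obtain ⟨K, hK⟩ := isCompact_Icc.exists_bound_of_continuousOn hcε
    refine memLp_top_of_bound ((hcε.mono Set.Ioc_subset_Icc_self).aestronglyMeasurable
      measurableSet_Ioc) K ?_
    filter_upwards [ae_restrict_mem measurableSet_Ioc] with s hs using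
      hK s (Set.Ioc_subset_Icc_self hs)
  have hemeas : AEStronglyMeasurable e I := by
    have h1 : AEStronglyMeasurable (fun s => WaveFEM.incl Ω (Urec s)) I :=
      (hcU.mono Set.Ioc_subset_Icc_self).aestronglyMeasurable measurableSet_Ioc
    have h2 : AEStronglyMeasurable (fun s => WaveFEM.incl Ω (u s)) I :=
      (WaveFEM.incl Ω).continuous.comp_aestronglyMeasurable hu2.1
    exact (h1.sub h2).congr (Filter.Eventually.of_forall fun s => (map_sub _ _ _).symm)
  have hε'int : ∫ s in (0 : ℝ)..(t N), ‖w' s - U' s‖ = ∫ s in (0 : ℝ)..(t N), ‖deriv ε s‖ := by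
    rw [intervalIntegral.integral_of_le hT0, intervalIntegral.integral_of_le hT0]
    refine integral_congr_ae ?_
    filter_upwards [hdε] with s hs
    rw [hs]
  -- the constants
  have hη1 := WaveFEM.eta1_eq hN ht ht0 V UL V0L hdU
  have hη3 : ∑ n ∈ Finset.Icc 1 N, 1 / Real.pi
      * √(∫ s in (t (n - 1))..(t n), WaveFEM.step t n ^ 3 * ‖WaveFEM.fbar t f n - f s‖ ^ 2)
      ≤ 2 * WaveFEM.eta3 t f N (t N) :=
    WaveFEM.sum_sqrt_le_eta _ hN fun n => Real.sqrt_nonneg _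
  have hη4 : ∑ n ∈ Finset.Icc 1 N, 1 / Real.pi
      * √(∫ s in (t (n - 1))..(t n), WaveFEM.step t n ^ 3
        * ‖WaveFEM.mu t n s • WaveFEM.bdiff2 t UL V0L n‖ ^ 2)
      ≤ 2 * WaveFEM.eta4 t UL V0L N (t N) :=
    WaveFEM.sum_sqrt_le_eta _ hN fun n => Real.sqrt_nonneg _
  have hη1nn : 0 ≤ WaveFEM.eta1 t V UL V0L (fun s => WaveFEM.incl Ω (Urec s)) N (t N) := by
    rw [hη1]
    refine add_nonneg (Finset.sum_nonneg fun n hn => ?_) (add_nonneg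
      (Finset.sum_nonneg fun n hn => ?_) (by positivity))
    · rw [Finset.mem_Icc] at hn
      exact intervalIntegral.integral_nonneg (WaveFEM.nodes_mono ht (by omega) hn.2)
        fun s _ => norm_nonneg _
    · rw [Finset.mem_Icc] at hn
      exact mul_nonneg (sub_nonneg.2 (WaveFEM.nodes_mono ht (by omega) le_rfl)) (norm_nonneg _)
  have hη2nn : 0 ≤ WaveFEM.eta2 t N g dg₀ (t N) :=
    intervalIntegral.integral_nonneg hT0 fun s _ => norm_nonneg _
  have hη3nn : 0 ≤ 2 * WaveFEM.eta3 t f N (t N) :=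
    (Finset.sum_nonneg fun n _ => by positivity).trans hη3
  have hη4nn : 0 ≤ 2 * WaveFEM.eta4 t UL V0L N (t N) :=
    (Finset.sum_nonneg fun n _ => by positivity).trans hη4
  have hε'nn : 0 ≤ ∫ s in (0 : ℝ)..(t N), ‖deriv ε s‖ :=
    intervalIntegral.integral_nonneg hT0 fun s _ => norm_nonneg _
  -- Duality gives this smaller minimum; both entries are enlarged to reach the stated constant.
  have hmin : min (t N) √(WaveFEM.poincareConst Ω / αmin)
      ≤ min (2 * t N) √(2 * WaveFEM.poincareConst Ω / αmin) := by
    refine min_le_min (by linarith) (Real.sqrt_le_sqrt ?_)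
    rw [mul_div_assoc]
    linarith
  have hmin0 : 0 ≤ min (2 * t N) √(2 * WaveFEM.poincareConst Ω / αmin) :=
    le_min (by linarith) (Real.sqrt_nonneg _)
  -- Time 0 belongs to none of the half-open intervals; the value comes from the separate branch of
  -- `timeRec`.
  have h0 : Urec 0 = U 0 := if_pos le_rfl
  have h0' : wrec 0 = w 0 := if_pos le_rfl
  have hr0 : ‖WaveFEM.incl Ω (w 0) - WaveFEM.incl Ω u₀‖
      ≤ √2 * (‖WaveFEM.incl Ω u₀ - WaveFEM.incl Ω (Urec 0)‖ + ‖ε 0‖) := by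
    have h1 : WaveFEM.incl Ω (w 0) - WaveFEM.incl Ω u₀
        = -(WaveFEM.incl Ω u₀ - WaveFEM.incl Ω (Urec 0)) + ε 0 := by
      rw [hε, h0']
      abel
    have h2 : ‖WaveFEM.incl Ω (w 0) - WaveFEM.incl Ω u₀‖
        ≤ ‖WaveFEM.incl Ω u₀ - WaveFEM.incl Ω (Urec 0)‖ + ‖ε 0‖ := by
      rw [h1]
      exact (norm_add_le _ _).trans (by rw [norm_neg])
    have h3 : (1 : ℝ) ≤ √2 := Real.one_le_sqrt.2 one_le_two
    exact h2.trans (le_mul_of_one_le_left (by positivity) h3)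
  have hpt : ∀ᵐ s ∂I, ‖e s‖ ≤ ‖ε s‖
      + (√2 * (‖WaveFEM.incl Ω u₀ - WaveFEM.incl Ω (Urec 0)‖ + ‖ε 0‖)
      + 2 * ((∫ s in (0 : ℝ)..(t N), ‖deriv ε s‖)
          + (WaveFEM.eta1 t V UL V0L (fun s => WaveFEM.incl Ω (Urec s)) N (t N)
            + WaveFEM.eta2 t N g dg₀ (t N)
            + WaveFEM.eta3 t f N (t N)
            + WaveFEM.eta4 t UL V0L N (t N)))
      + min (2 * t N) √(2 * WaveFEM.poincareConst Ω / αmin) * ‖u₁ - V0L‖) := by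
    filter_upwards [hbound] with s hs
    have h1 : e s = WaveFEM.incl Ω (wrec s - u s) - ε s := by
      rw [hε]
      simp only [e, map_sub]
      abel
    have h2 : ‖e s‖ ≤ ‖WaveFEM.incl Ω (wrec s - u s)‖ + ‖ε s‖ := h1 ▸ norm_sub_le _ _
    have h3 : min (t N) √(WaveFEM.poincareConst Ω / αmin) * ‖V0L - u₁‖
        ≤ min (2 * t N) √(2 * WaveFEM.poincareConst Ω / αmin) * ‖u₁ - V0L‖ := by
      rw [norm_sub_rev]
      exact mul_le_mul_of_nonneg_right hmin (norm_nonneg _)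
    have h4 : WaveFEM.eta2 t N g dg₀ (t N)
      = ∫ s in (0 : ℝ)..(t N), ‖WaveFEM.evolG t N g dg₀ s‖ := rfl
    rw [hε'int, ← hη1, ← h4] at hs
    linarith
  have hK : 0 ≤ (∫ s in (0 : ℝ)..(t N), ‖deriv ε s‖)
      + (WaveFEM.eta1 t V UL V0L (fun s => WaveFEM.incl Ω (Urec s)) N (t N)
        + WaveFEM.eta2 t N g dg₀ (t N) + WaveFEM.eta3 t f N (t N)
        + WaveFEM.eta4 t UL V0L N (t N)) := by linarith
  have hfin := WaveFEM.toReal_eLpNorm_top_le hεmem hemeas (add_nonneg (add_nonneg (by positivity)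
    (mul_nonneg zero_le_two hK)) (mul_nonneg hmin0 (norm_nonneg _))) hpt
  refine ⟨hfin.1, hεmem, ?_, ?_⟩
  · exact ((hiw'.sub hiU').integrableOn).congr (hdε.mono fun s hs => hs.symm)
  · refine hfin.2.trans (le_of_eq ?_)
    ring
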